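/- Let $\mathcal X\subseteq\mathbb R^N$ and $\mathcal Z_m\subseteq\mathbb R^{J_m}$ ($m=1,\dots,M$) be non-empty, compact and convex. Let $f_0:\mathbb R^N\to\mathbb R\cup\{+\infty\}$ be convex and finite on $\mathcal X$. Let $g_m:\mathbb R^N\times\mathbb R^{J_m}\to\mathbb R\cup\{\pm\infty\}$ be finite on $\mathcal X\times\mathcal Z_m$, with $g_m(\cdot,z_m)$ convex for every $z_m\in\mathcal Z_m$ and $g_m(x,\cdot)$ concave for every $x\in\mathcal X$. Put $f_m(x)=\max_{z_m\in\mathcal Z_m}g_m(x,z_m)$ and consider the robust problem $$\min\{f_0(x): x\in\mathcal X,\ f_m(x)\le 0\ \text{for all } m\}.$$ Assume that it has an optimal solution $x^\star$ and that there is a Slater point $\bar x\in\mathcal X$ with $f_m(\bar x)<0$ for all $m$. Assume further that for all $x\in\mathcal X$, $z_m\in\mathcal Z_m$ the subdifferentials $\partial f_0(x)$, $\partial_x g_m(x,z_m)$, $\partial_{z_m}(-g_m)(x,z_m)$ are non-empty and that their elements have Euclidean norm at most $D_0$, $D_m$, $B_m$ respectively, where the constants $D_0,D_m,B_m>0$ do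 not depend on $x,z_m$. A point $x\in\mathcal X$ is called $\varepsilon$-approximate optimal if $f_0(x)-f_0(x^\star)\le\varepsilon$ and $\max_m\max\{f_m(x),0\}\le\varepsilon$. The algorithm ProM$^3$ with parameters $K,T\ge1$ and $\alpha,\beta,\gamma,\delta,\theta,\nu>0$ is the following. *Outer algorithm.* Start with $\lambda^0=0$ and any $x^0\in\mathcal X$. For $k=0,\dots,K-1$: find $z^k_m\in\mathcal Z_m$ with $f_m(x^k)-g_m(x^k,z_m^k)\le\theta$ for each $m$; with $g^k=(g_m(x^k,z^k_m))_m$ and $g^{-1}=g^0$, put $\lambda^{k+1}=\max\{\lambda^k+\beta(2g^k-g^{k-1}),0\}$ (componentwise). Let $(x^{k+1},\tilde z^{k+1})$ be the output of the inner algorithm for $(\lambda^{k+1},x^k)$. It is required to be a strong $\nu$-approximate saddle point of $F(x,z)=f_0(x)+\sum_m\lambda^{k+1}_m g_m(x,z_m)+\frac1{2\alpha}\|x-x^k\|^2$, that is, with $\mathcal Z=\mathcal Z_1\times\dots\times\mathcal Z_M$, $F(x^{k+1},v)\le F(u,\tilde z^{k+1})-\frac1{2\alpha}\|u-x^{k+1}\|^2+\nu$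 for all $u\in\mathcal X$, $v\in\mathcal Z$. Output $\frac1K\sum_{k=1}^Kx^k$. *Inner algorithm.* Start with any $x_0\in\mathcal X$, $z_0\in\mathcal Z$. For $t=0,\dots,T-1$: take $\zeta_{t,m}\in\partial_{z_m}(-g_m)(x_t,z_{t,m})$ (with $\zeta_{-1,m}=\zeta_{0,m}$) and put $z_{t+1,m}=\mathrm{Proj}_{\mathcal Z_m}\big(z_{t,m}-\delta\lambda^{k+1}_m(2\zeta_{t,m}-\zeta_{t-1,m})\big)$; take $\xi_{t,0}\in\partial f_0(x_t)$, $\xi_{t,m}\in\partial_xg_m(x_t,z_{t+1,m})$, put $\xi_t=\xi_{t,0}+\sum_m\lambda^{k+1}_m\xi_{t,m}$ and $x_{t+1}=\mathrm{Proj}_{\mathcal X}\big(\frac{\alpha\gamma}{\alpha+\gamma}(\frac1\alpha x^k+\frac1\gamma x_t-\xi_t)\big)$. Output $\frac1T\sum_{t=1}^T(x_t,z_t)$. **Theorem.** Let $\alpha,\beta>0$ with $\alpha\sqrt{\sum_mD_m^2}\le1$ and $2\beta\sqrt{\sum_mD_m^2}\le1$. There are constants $c_K,c_T,c_S,C>0$,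 depending only on the problem, on the constants $D_0,D_m,B_m$ and on $\alpha,\beta$, such that for every $\varepsilon>0$ the following holds for ProM$^3$ with $K=\lceil c_K/\varepsilon\rceil$, $\theta=\nu=1/K$, $T=\lceil c_TK^2\rceil$, $\gamma=\delta=1/\sqrt T$. For every $x^0\in\mathcal X$, all starting points of the inner algorithm, all subgradients returned by the oracles and all choices of the $z^k_m$, each step can be carried out, each inner output is a strong $\nu$-approximate saddle point as required, the output of ProM$^3$ is $\varepsilon$-approximate optimal, and the total number of calls to the subgradient oracles of $f_0,g_m$ and the projection oracles of $\mathcal X,\mathcal Z_m$, not counting the search for the $z^k_m$, is at most $C\max\{1,\varepsilon^{-3}\}$; in particular it is $\mathcal O(\varepsilon^{-3})$ as $\varepsilon\to0$. The same holds, with all calls counted, when $(z_m^k)_m$ is computed by averaging the points $w_{0,m},\dots,w_{S-1,m}$ visited by projected subgradient ascent $w_{j+1,m}=\mathrm{Proj}_{\mathcal Z_m}(w_{j,m}-S^{-1/2}\zeta_{j,m})$, $\zeta_{j,m}\in\partial_{z_m}(-g_m)(x^k,w_{j,m})$, with $S=\lceil c_SK^2\rceil$ and any $w_0\in\mathcal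 Z$. -/

import Mathlib

open scoped BigOperators

/-- Real `n`-space with the Euclidean norm. -/
abbrev Vec (n : ℕ) : Type := EuclideanSpace ℝ (Fin n)

/-! ### Extended-real-valued convex analysis -/

/-- Convexity of an extended-real-valued function: its epigraph is convex. -/
def EConvex {n : ℕ} (f : Vec n → EReal) : Prop :=
  Convex ℝ {p : Vec n × ℝ | f p.1 ≤ (p.2 : EReal)}

/-- The convex subdifferential `∂ f (x)`. -/
def subdiff {n : ℕ} (f : Vec n → EReal) (x : Vec n) : Set (Vec n) :=
  {ξ | ∀ y, f x + ((inner ℝ ξ (y - x) : ℝ) : EReal) ≤ f y}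

/-- `p` is the Euclidean projection of `y` onto `S`. -/
def IsProj {n : ℕ} (S : Set (Vec n)) (y p : Vec n) : Prop :=
  p ∈ S ∧ ∀ w ∈ S, ‖y - p‖ ≤ ‖y - w‖

/-! ### The robust problem and its assumptions -/

/-- Data of the robust problem: minimise `f0 x` over `x ∈ X` subject to
`max_{z ∈ Z m} g m x z ≤ 0` for all `m`. -/
structure RobustProblem (N M : ℕ) (J : Fin M → ℕ) where
  X : Set (Vec N)
  Z : (m : Fin M) → Set (Vec (J m))
  f0 : Vec N → EReal
  g : (m : Fin M) → Vec N → Vec (J m) → EReal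

namespace RobustProblem

variable {N M : ℕ} {J : Fin M → ℕ}

/-- The worst-case constraint function `f_m x = max_{z ∈ Z m} g m x z`. -/
noncomputable def worst (P : RobustProblem N M J) (m : Fin M) (x : Vec N) : EReal :=
  ⨆ z ∈ P.Z m, P.g m x z

def IsFeasible (P : RobustProblem N M J) (x : Vec N) : Prop :=
  x ∈ P.X ∧ ∀ m, P.worst m x ≤ 0

def IsOptimal (P : RobustProblem N M J) (x : Vec N) : Prop :=
  P.IsFeasible x ∧ ∀ y, P.IsFeasible y → P.f0 x ≤ P.f0 y

/-- Optimality gap at most `ε` and constraint violation `max_m [f_m x]_+` at most `ε`. -/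
def IsApproxOptimal (P : RobustProblem N M J) (ε : ℝ) (x : Vec N) : Prop :=
  x ∈ P.X ∧ (∃ xs, P.IsOptimal xs ∧ P.f0 x ≤ P.f0 xs + (ε : EReal)) ∧
    ∀ m, max (P.worst m x) 0 ≤ (ε : EReal)

/-- The standing assumptions of robust convex optimization. -/
structure Standing (P : RobustProblem N M J) : Prop where
  X_nonempty : P.X.Nonempty
  X_compact : IsCompact P.X
  X_convex : Convex ℝ P.X
  Z_nonempty : ∀ m, (P.Z m).Nonempty
  Z_compact : ∀ m, IsCompact (P.Z m)
  Z_convex : ∀ m, Convex ℝ (P.Z m)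
  f0_ne_bot : ∀ x, P.f0 x ≠ ⊥
  f0_finite : ∀ x ∈ P.X, P.f0 x ≠ ⊤
  f0_convex : EConvex P.f0
  g_finite : ∀ m, ∀ x ∈ P.X, ∀ z ∈ P.Z m, P.g m x z ≠ ⊥ ∧ P.g m x z ≠ ⊤
  g_convex : ∀ m, ∀ z ∈ P.Z m, EConvex (fun x => P.g m x z)
  g_concave : ∀ m, ∀ x ∈ P.X, EConvex (fun z => -P.g m x z)
  slater : ∃ x ∈ P.X, ∀ m, P.worst m x < 0
  optimum : ∃ x, P.IsOptimal x

/-- Subdifferentiability with uniformly bounded subdifferentials, with bounds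
`D0` for `∂ f0`, `D m` for `∂_x g m` and `B m` for `∂_z (-g m)`. -/
structure BoundedSubdiff (P : RobustProblem N M J) (D0 : ℝ) (D B : Fin M → ℝ) : Prop where
  D0_pos : 0 < D0
  D_pos : ∀ m, 0 < D m
  B_pos : ∀ m, 0 < B m
  f0_nonempty : ∀ x ∈ P.X, (subdiff P.f0 x).Nonempty
  gx_nonempty : ∀ m, ∀ x ∈ P.X, ∀ z ∈ P.Z m, (subdiff (fun x' => P.g m x' z) x).Nonempty
  gz_nonempty : ∀ m, ∀ x ∈ P.X, ∀ z ∈ P.Z m, (subdiff (fun z' => -P.g m x z') z).Nonempty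
  f0_bound : ∀ x ∈ P.X, ∀ ξ ∈ subdiff P.f0 x, ‖ξ‖ ≤ D0
  gx_bound : ∀ m, ∀ x ∈ P.X, ∀ z ∈ P.Z m, ∀ ξ ∈ subdiff (fun x' => P.g m x' z) x, ‖ξ‖ ≤ D m
  gz_bound : ∀ m, ∀ x ∈ P.X, ∀ z ∈ P.Z m, ∀ ζ ∈ subdiff (fun z' => -P.g m x z') z, ‖ζ‖ ≤ B m

/-- Every `z m` is a `θ`-approximate maximiser of `g m x` over `Z m`. -/
def IsApproxMaximiser (P : RobustProblem N M J) (θ : ℝ) (x : Vec N) (m : Fin M)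
    (z : Vec (J m)) : Prop :=
  z ∈ P.Z m ∧ P.worst m x ≤ P.g m x z + (θ : EReal)

/-- Objective of the inner saddle-point problem,
`f0 x + ∑ m, lam m * g m x (z m) + ‖x - xk‖² / (2 α)`; it is used only on `X × Z`, where
`f0` and `g` are finite. -/
noncomputable def innerObj (P : RobustProblem N M J) (α : ℝ) (lam : Fin M → ℝ) (xk : Vec N)
    (x : Vec N) (z : (m : Fin M) → Vec (J m)) : ℝ :=
  (P.f0 x).toReal + ∑ m, lam m * (P.g m x (z m)).toReal + 1 / (2 * α) * ‖x - xk‖ ^ 2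

/-- `(x, z)` is a strong `ν`-approximate saddle point of the inner problem, whose objective is
`1 / α`-strongly convex in `x`. -/
def IsStrongApproxSaddle (P : RobustProblem N M J) (α ν : ℝ) (lam : Fin M → ℝ) (xk : Vec N)
    (x : Vec N) (z : (m : Fin M) → Vec (J m)) : Prop :=
  x ∈ P.X ∧ (∀ m, z m ∈ P.Z m) ∧
    ∀ u ∈ P.X, ∀ v : (m : Fin M) → Vec (J m), (∀ m, v m ∈ P.Z m) →
      P.innerObj α lam xk x v ≤ P.innerObj α lam xk u z - (1 / α) / 2 * ‖u - x‖ ^ 2 + ν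

end RobustProblem

/-! ### Programs with oracle calls -/

/-- What a first-order method may ask for. The first five requests are the subgradient and
projection oracles. The last two are steps that an algorithm leaves unspecified: picking an
arbitrary `θ`-approximate maximiser, and picking an arbitrary starting point in `X × Z`. -/
inductive Request (N M : ℕ) (J : Fin M → ℕ) : Type
  | objSubgrad (x : Vec N)
  | conSubgrad (m : Fin M) (x : Vec N) (z : Vec (J m))
  | uncSubgrad (m : Fin M) (x : Vec N) (z : Vec (J m))
  | projX (y : Vec N)
  | projZ (m : Fin M) (y : Vec (J m))
  | pickMax (θ : ℝ) (m : Fin M) (x : Vec N)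
  | pickStart

namespace Request

variable {N M : ℕ} {J : Fin M → ℕ}

/-- The type of answers to a request. -/
abbrev Answer : Request N M J → Type
  | objSubgrad _ => Vec N
  | conSubgrad _ _ _ => Vec N
  | uncSubgrad m _ _ => Vec (J m)
  | projX _ => Vec N
  | projZ m _ => Vec (J m)
  | pickMax _ m _ => Vec (J m)
  | pickStart => Vec N × ((m : Fin M) → Vec (J m))

/-- The answers that are correct for the problem `P`. -/
def Valid (P : RobustProblem N M J) : (q : Request N M J) → q.Answer → Prop
  | objSubgrad x => fun ξ => ξ ∈ subdiff P.f0 x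
  | conSubgrad m x z => fun ξ => ξ ∈ subdiff (fun x' => P.g m x' z) x
  | uncSubgrad m x z => fun ζ => ζ ∈ subdiff (fun z' => -P.g m x z') z
  | projX y => fun p => IsProj P.X y p
  | projZ m y => fun p => IsProj (P.Z m) y p
  | pickMax θ m x => fun z => P.IsApproxMaximiser θ x m z
  | pickStart => fun s => s.1 ∈ P.X ∧ ∀ m, s.2 m ∈ P.Z m

/-- The number of subgradient and projection oracle calls in a request. -/
def calls : Request N M J → ℕ
  | objSubgrad _ => 1
  | conSubgrad _ _ _ => 1
  | uncSubgrad _ _ _ => 1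
  | projX _ => 1
  | projZ _ _ => 1
  | pickMax _ _ _ => 0
  | pickStart => 0

end Request

/-- Programs: return a value, issue `n` requests and continue with the answers, or claim that
`p` holds at this point and continue. -/
inductive Prog (N M : ℕ) (J : Fin M → ℕ) (R : Type) : Type
  | ret (r : R) : Prog N M J R
  | ask (n : ℕ) (q : Fin n → Request N M J)
      (k : ((i : Fin n) → (q i).Answer) → Prog N M J R) : Prog N M J R
  | check (p : Prop) (k : Prog N M J R) : Prog N M J R

namespace Prog

variable {N M : ℕ} {J : Fin M → ℕ} {R R' : Type}

/-- Sequential composition. -/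
def bind : Prog N M J R → (R → Prog N M J R') → Prog N M J R'
  | ret r, c => c r
  | ask n q k, c => ask n q fun a => (k a).bind c
  | check p k, c => check p (k.bind c)

/-- Total correctness with cost: every request issued has a correct answer, and for *all* choices
of correct answers every claim made on the way is true and the program ends with a result `r`
after a number `c` of oracle calls such that `post r c`. -/
def Ensures (P : RobustProblem N M J) : Prog N M J R → (R → ℕ → Prop) → Prop
  | ret r, post => post r 0
  | ask _ q k, post => (∀ i, ∃ a, (q i).Valid P a) ∧
      ∀ a, (∀ i, (q i).Valid P (a i)) →
        (k a).Ensures P fun r c => post r (∑ i, (q i).calls + c)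
  | check p k, post => p ∧ k.Ensures P post

end Prog

/-! ### The algorithm -/

section Algorithm

variable {N M : ℕ} {J : Fin M → ℕ}

/-- The remaining iterations of the inner algorithm, at the current iterate `(x, z)`, with the
previous subgradients `ζp` (`none` in the first iteration) and the sums `sx`, `sz` of the iterates
produced so far. -/
noncomputable def innerLoop (α γ δ : ℝ) (lam : Fin M → ℝ) (xk : Vec N) :
    ℕ → Vec N → ((m : Fin M) → Vec (J m)) → Option ((m : Fin M) → Vec (J m)) →
      Vec N → ((m : Fin M) → Vec (J m)) → Prog N M J (Vec N × ((m : Fin M) → Vec (J m)))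
  | 0, _, _, _, sx, sz => .ret (sx, sz)
  | t + 1, x, z, ζp, sx, sz =>
    .ask M (fun m => .uncSubgrad m x (z m)) fun ζ =>
    .ask M (fun m => .projZ m
      (z m - (δ * lam m) • ((2 : ℝ) • ζ m - (ζp.getD ζ) m))) fun z' =>
    .ask 1 (fun _ => .objSubgrad x) fun ξ0 =>
    .ask M (fun m => .conSubgrad m x (z' m)) fun ξ =>
    .ask 1 (fun _ => .projX
      ((α * γ / (α + γ)) •
        ((1 / α) • xk + (1 / γ) • x - (ξ0 0 + ∑ m, lam m • ξ m)))) fun x' =>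
    innerLoop α γ δ lam xk t (x' 0) z' (some ζ) (sx + x' 0) (fun m => sz m + z' m)

/-- The inner algorithm: `T` iterations from an arbitrary starting point of `X × Z`, returning the
averages of the iterates number `1, …, T`. -/
noncomputable def innerAlg (T : ℕ) (α γ δ : ℝ) (lam : Fin M → ℝ) (xk : Vec N) :
    Prog N M J (Vec N × ((m : Fin M) → Vec (J m))) :=
  .ask 1 (fun _ => .pickStart) fun s =>
    (innerLoop α γ δ lam xk T (s 0).1 (s 0).2 none 0 (fun _ => 0)).bind fun r =>
      .ret ((1 / (T : ℝ)) • r.1, fun m => (1 / (T : ℝ)) • r.2 m)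

/-- The maximisation step with the approximate maximisers given for free. -/
def findByPick (θ : ℝ) (x : Vec N) : Prog N M J ((m : Fin M) → Vec (J m)) :=
  .ask M (fun m => .pickMax θ m x) fun z => .ret z

/-- Projected subgradient ascent on every `g m x` over `Z m`, with the sums `sz` of the points
visited so far. -/
noncomputable def ascentLoop (s : ℝ) (x : Vec N) :
    ℕ → ((m : Fin M) → Vec (J m)) → ((m : Fin M) → Vec (J m)) →
      Prog N M J ((m : Fin M) → Vec (J m))
  | 0, _, sz => .ret sz
  | t + 1, z, sz =>
    .ask M (fun m => .uncSubgrad m x (z m)) fun ζ =>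
    .ask M (fun m => .projZ m (z m - s • ζ m)) fun z' =>
    ascentLoop s x t z' (fun m => sz m + z m)

/-- The maximisation step carried out by `S` iterations of projected subgradient ascent with step
size `s` from an arbitrary starting point, returning the average of the points visited. -/
noncomputable def findByAscent (S : ℕ) (s : ℝ) (x : Vec N) :
    Prog N M J ((m : Fin M) → Vec (J m)) :=
  .ask 1 (fun _ => .pickStart) fun st =>
    (ascentLoop s x S (st 0).2 (fun _ => 0)).bind fun sz =>
      .ret (fun m => (1 / (S : ℝ)) • sz m)

/-- The remaining iterations of the outer algorithm, at the current `x = x^k` and `lam = λ^k`, with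
the previous constraint values `gp` (`none` in the first iteration) and the sum `sx` of the iterates
produced so far. `find` computes the approximate maximisers `z^k`, `inner` performs the `x`-update.
The program claims that they meet the requirements of the outer algorithm. -/
noncomputable def outerLoop (P : RobustProblem N M J) (α β θ ν : ℝ)
    (find : Vec N → Prog N M J ((m : Fin M) → Vec (J m)))
    (inner : (Fin M → ℝ) → Vec N → Prog N M J (Vec N × ((m : Fin M) → Vec (J m)))) :
    ℕ → Vec N → (Fin M → ℝ) → Option (Fin M → ℝ) → Vec N → Prog N M J (Vec N)
  | 0, _, _, _, sx => .ret sx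
  | j + 1, x, lam, gp, sx =>
    (find x).bind fun z =>
    .check (∀ m, P.IsApproxMaximiser θ x m (z m)) <|
    let gz : Fin M → ℝ := fun m => (P.g m x (z m)).toReal
    let lam' : Fin M → ℝ := fun m => max (lam m + β * (2 * gz m - (gp.getD gz) m)) 0
    (inner lam' x).bind fun r =>
    .check (P.IsStrongApproxSaddle α ν lam' x r.1 r.2) <|
    outerLoop P α β θ ν find inner j r.1 lam' (some gz) (sx + r.1)

/-- The proximal max-min-max algorithm: `K` outer iterations from `λ^0 = 0` and `x^0 = x0`, each
`x`-update being done by `T` iterations of the inner algorithm; the result is the average of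
`x^1, …, x^K`. -/
noncomputable def proM3 (P : RobustProblem N M J) (α β θ ν : ℝ)
    (find : Vec N → Prog N M J ((m : Fin M) → Vec (J m)))
    (K T : ℕ) (γ δ : ℝ) (x0 : Vec N) : Prog N M J (Vec N) :=
  (outerLoop P α β θ ν find (innerAlg T α γ δ) K x0 (fun _ => 0) none 0).bind fun sx =>
    .ret ((1 / (K : ℝ)) • sx)

end Algorithm

/-! ### Program logic for oracle programs. -/

namespace Prog

variable {N M : ℕ} {J : Fin M → ℕ} {R R' : Type} {P : RobustProblem N M J}

/-! ProM³ is an inexact primal-dual proximal method on the Lagrangian `L(x, μ) = f₀(x) + ∑ μ_m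
f_m(x)`. If each outer step is exact up to `O(1/K)`, a telescoping potential gives `L(x̂, μ) -
f₀(x*) ≤ budget(μ) / K` at the averaged iterate `x̂`, for every `μ ≥ 0`. Testing `μ = 0` bounds the
optimality gap. Testing an optimal multiplier raised by one in coordinate `m` bounds the violation
of constraint `m`. Such multipliers exist by Slater's condition and a separation argument
(`exists_multipliers`).

In `outer_step` the extrapolation `2g^k - g^{k-1}` leaves a telescoping term and a product of
successive changes of `λ` and `g`. The latter is paid by the squared steps of `λ` and `x`, which is
where the bounds on `α` and `β` enter (`sum_mul_sq_le`).

The inner algorithm has the same structure with subgradients extrapolated in place of values. Its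
error per iteration is of order `γ + δ`, so `γ = δ = 1/√T` makes the averaged gap `O(1/√T)`
(`inner_step`, `innerAlg_ensures`), and `T ~ K²` reaches accuracy `1/K`. The constant grows with the
multipliers `λ^k`, so these need a bound independent of `K`. The outer potential supplies it: the
gap against an optimal primal-dual pair is nonnegative, hence `λ^k` stays near the optimal
multiplier (`OuterInvariant.multiplier_le`). The cost is `K · O(K²) = O(K³)` calls, with or without
the ascent steps.

Each loop is verified by induction on the remaining iterations. A list of past iterates, absent from
the program, serves as ghost state, and Jensen's inequality on it passes to averages. -/

theorem Ensures.mono {p : Prog N M J R} {post post' : R → ℕ → Prop} (h : p.Ensures P post)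
    (hpost : ∀ r c, post r c → post' r c) : p.Ensures P post' := by
  induction p generalizing post post' with
  | ret r => exact hpost _ _ h
  | ask n q k ih =>
    exact ⟨h.1, fun a ha => ih a (h.2 a ha) fun r c => hpost _ _⟩
  | check p k ih => exact ⟨h.1, ih h.2 hpost⟩

/-- The sequencing rule of the program logic: the cost already spent is pushed into the
postcondition of the continuation, so costs add up. -/
theorem Ensures.bind {p : Prog N M J R} {k : R → Prog N M J R'} {post : R' → ℕ → Prop}
    (h : p.Ensures P fun r c => (k r).Ensures P fun r' c' => post r' (c + c')) :
    (p.bind k).Ensures P post := by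
  induction p generalizing post with
  | ret r => simpa [Prog.bind, Ensures] using h
  | ask n q k' ih =>
    refine ⟨h.1, fun a ha => ih a ((h.2 a ha).mono fun r c hr => hr.mono fun r' c' => ?_)⟩
    simp only [add_assoc, imp_self]
  | check p k' ih => exact ⟨h.1, ih h.2⟩

end Prog

/-! ### Projections, three-point inequalities and Jensen's inequality for lists. -/

section Projection

variable {n : ℕ}

theorem exists_isProj {S : Set (Vec n)} (hne : S.Nonempty) (hS : IsCompact S) (y : Vec n) :
    ∃ p, IsProj S y p := by
  obtain ⟨p, hp, hmin⟩ := hS.exists_isMinOn hne (f := fun w => ‖y - w‖) (by fun_prop)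
  exact ⟨p, hp, fun w hw => hmin hw⟩

theorem IsProj.inner_le_zero {S : Set (Vec n)} (hS : Convex ℝ S) {y p : Vec n} (h : IsProj S y p)
    {w : Vec n} (hw : w ∈ S) : inner ℝ (y - p) (w - p) ≤ 0 := by
  refine (norm_eq_iInf_iff_real_inner_le_zero hS h.1).1 ?_ w hw
  have : Nonempty S := ⟨⟨p, h.1⟩⟩
  refine le_antisymm (le_ciInf fun w => h.2 w w.2) ?_
  exact ciInf_le (f := fun w : S => ‖y - w‖) ⟨0, by rintro _ ⟨w, rfl⟩; exact norm_nonneg _⟩ ⟨p, h.1⟩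

theorem inner_sub_sub_eq (a b c : Vec n) :
    inner ℝ (a - b) (c - a) = (‖c - b‖ ^ 2 - ‖c - a‖ ^ 2 - ‖a - b‖ ^ 2) / 2 := by
  have : c - b = (c - a) + (a - b) := by abel
  rw [this, norm_add_sq_real, real_inner_comm]
  ring

/-- The three-point inequality for a projected subgradient step. -/
theorem IsProj.three_point {S : Set (Vec n)} (hS : Convex ℝ S) {z a p v : Vec n}
    (h : IsProj S (z - a) p) (hv : v ∈ S) :
    inner ℝ a (p - v) ≤ (‖v - z‖ ^ 2 - ‖v - p‖ ^ 2 - ‖p - z‖ ^ 2) / 2 := by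
  have h1 := h.inner_le_zero hS hv
  rw [← inner_sub_sub_eq p z v]
  simp only [inner_sub_left, inner_sub_right] at h1 ⊢
  linarith

/-- The three-point inequality for a proximal step with two quadratic terms. -/
theorem IsProj.prox_three_point {S : Set (Vec n)} (hS : Convex ℝ S) {α γ : ℝ} (hα : 0 < α)
    (hγ : 0 < γ) {xk x ξ p u : Vec n}
    (h : IsProj S ((α * γ / (α + γ)) • ((1 / α) • xk + (1 / γ) • x - ξ)) p) (hu : u ∈ S) :
    inner ℝ ξ (p - u) ≤ 1 / (2 * α) * (‖u - xk‖ ^ 2 - ‖u - p‖ ^ 2 - ‖p - xk‖ ^ 2) +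
      1 / (2 * γ) * (‖u - x‖ ^ 2 - ‖u - p‖ ^ 2 - ‖p - x‖ ^ 2) := by
  have h1 := h.inner_le_zero hS hu
  have hc : 0 < α * γ / (α + γ) := by positivity
  -- The scaling factor is the inverse of `1/α + 1/γ`. Factoring it out turns the projection
  -- inequality into the optimality condition of the proximal step with both quadratic terms.
  have h2 : (α * γ / (α + γ)) • ((1 / α) • xk + (1 / γ) • x - ξ) - p =
      (α * γ / (α + γ)) • ((1 / α) • (xk - p) + (1 / γ) • (x - p) - ξ) := by
    have : p = (α * γ / (α + γ)) • ((1 / α) • p + (1 / γ) • p) := by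
      rw [← add_smul, smul_smul]
      have : α * γ / (α + γ) * (1 / α + 1 / γ) = 1 := by field_simp; ring
      rw [this, one_smul]
    nth_rewrite 1 [this]
    rw [← smul_sub]
    congr 1
    simp only [smul_sub]
    abel
  rw [h2, real_inner_smul_left] at h1
  have h3 : inner ℝ ((1 / α) • (xk - p) + (1 / γ) • (x - p) - ξ) (u - p) ≤ 0 := by
    by_contra hcon
    push Not at hcon
    have := mul_pos hc hcon
    linarith
  have e1 := inner_sub_sub_eq p xk u
  have e2 := inner_sub_sub_eq p x u
  have e3 : 1 / (2 * α) * (‖u - xk‖ ^ 2 - ‖u - p‖ ^ 2 - ‖p - xk‖ ^ 2) =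
      1 / α * inner ℝ (p - xk) (u - p) := by rw [e1]; field_simp
  have e4 : 1 / (2 * γ) * (‖u - x‖ ^ 2 - ‖u - p‖ ^ 2 - ‖p - x‖ ^ 2) =
      1 / γ * inner ℝ (p - x) (u - p) := by rw [e2]; field_simp
  rw [e3, e4]
  rw [inner_sub_left, inner_add_left, real_inner_smul_left, real_inner_smul_left,
    ← neg_sub p xk, ← neg_sub p x, inner_neg_left, inner_neg_left] at h3
  rw [← neg_sub u p, inner_neg_right]
  linarith

/-- Jensen's inequality for the average of a list, at a point with a subgradient. -/
theorem length_mul_le_sum_of_subgradient {ι : Type*} (l : List ι) (a : ι → Vec n)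
    (φ : Vec n → ℝ) {p ξ : Vec n} (h : ∀ i ∈ l, φ p + inner ℝ ξ (a i - p) ≤ φ (a i))
    (hp : (l.length : ℝ) • p = (l.map a).sum) :
    l.length * φ p ≤ (l.map fun i => φ (a i)).sum := by
  have key : ∀ l : List ι, (∀ i ∈ l, φ p + inner ℝ ξ (a i - p) ≤ φ (a i)) →
      l.length * φ p + inner ℝ ξ ((l.map a).sum - (l.length : ℝ) • p) ≤
        (l.map fun i => φ (a i)).sum := by
    intro l
    induction l with
    | nil => simp
    | cons i l ih =>
      intro h
      have h1 := ih fun j hj => h j (List.mem_cons_of_mem _ hj)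
      have h2 := h i List.mem_cons_self
      have h3 : a i + (l.map a).sum - ((l.length : ℝ) + 1) • p =
          (a i - p) + ((l.map a).sum - (l.length : ℝ) • p) := by
        rw [add_smul, one_smul]; abel
      simp only [List.map_cons, List.sum_cons, List.length_cons, Nat.cast_add, Nat.cast_one]
      rw [h3, inner_add_right]
      linarith
  simpa [hp] using key l h

theorem average_mem {ι : Type*} {S : Set (Vec n)} (hS : Convex ℝ S) (l : List ι) (a : ι → Vec n)
    (h : ∀ i ∈ l, a i ∈ S) (hl : l ≠ []) : (1 / (l.length : ℝ)) • (l.map a).sum ∈ S := by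
  induction l with
  | nil => exact absurd rfl hl
  | cons i l ih =>
    by_cases hn : l = []
    · subst hn; simpa using h
    · have h1 := ih (fun j hj => h j (List.mem_cons_of_mem _ hj)) hn
      have hpos : 0 < (l.length : ℝ) := by exact_mod_cast List.length_pos_iff.2 hn
      have h2 := hS (h i List.mem_cons_self) h1 (a := 1 / ((l.length : ℝ) + 1))
        (b := l.length / ((l.length : ℝ) + 1)) (by positivity) (by positivity)
        (by field_simp; ring)
      rw [smul_smul] at h2
      have e : (l.length : ℝ) / (l.length + 1) * (1 / l.length) = 1 / ((l.length : ℝ) + 1) := by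
        field_simp
      rw [e, ← smul_add] at h2
      simpa using h2

end Projection

/-! ### Real-valued data on the compact sets: Lipschitz bounds and attained worst cases. -/

namespace RobustProblem

variable {N M : ℕ} {J : Fin M → ℕ}

/-- The objective as a real-valued function. -/
noncomputable def obj (P : RobustProblem N M J) (x : Vec N) : ℝ := (P.f0 x).toReal

/-- The constraint functions as real-valued functions. -/
noncomputable def con (P : RobustProblem N M J) (m : Fin M) (x : Vec N) (z : Vec (J m)) : ℝ :=
  (P.g m x z).toReal

/-- The worst-case constraint functions as real-valued functions. -/
noncomputable def wc (P : RobustProblem N M J) (m : Fin M) (x : Vec N) : ℝ :=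
  (P.worst m x).toReal

variable {P : RobustProblem N M J}

theorem coe_obj (hP : P.Standing) {x : Vec N} (hx : x ∈ P.X) : ((P.obj x : ℝ) : EReal) = P.f0 x :=
  EReal.coe_toReal (hP.f0_finite x hx) (hP.f0_ne_bot x)

theorem coe_con (hP : P.Standing) {m : Fin M} {x : Vec N} (hx : x ∈ P.X) {z : Vec (J m)}
    (hz : z ∈ P.Z m) : ((P.con m x z : ℝ) : EReal) = P.g m x z :=
  EReal.coe_toReal (hP.g_finite m x hx z hz).2 (hP.g_finite m x hx z hz).1

theorem obj_subgrad (hP : P.Standing) {x y ξ : Vec N} (hx : x ∈ P.X) (hy : y ∈ P.X)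
    (h : ξ ∈ subdiff P.f0 x) : P.obj x + inner ℝ ξ (y - x) ≤ P.obj y := by
  have h1 := h y
  rw [← coe_obj hP hx, ← coe_obj hP hy] at h1
  exact_mod_cast h1

theorem con_subgrad (hP : P.Standing) {m : Fin M} {x y ξ : Vec N} (hx : x ∈ P.X) (hy : y ∈ P.X)
    {z : Vec (J m)} (hz : z ∈ P.Z m) (h : ξ ∈ subdiff (fun x' => P.g m x' z) x) :
    P.con m x z + inner ℝ ξ (y - x) ≤ P.con m y z := by
  have h1 := h y
  simp only [← coe_con hP hx hz, ← coe_con hP hy hz] at h1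
  exact_mod_cast h1

theorem con_supergrad (hP : P.Standing) {m : Fin M} {x : Vec N} (hx : x ∈ P.X)
    {z v ζ : Vec (J m)} (hz : z ∈ P.Z m) (hv : v ∈ P.Z m)
    (h : ζ ∈ subdiff (fun z' => -P.g m x z') z) :
    P.con m x v + inner ℝ ζ (v - z) ≤ P.con m x z := by
  have h1 := h v
  simp only [← coe_con hP hx hz, ← coe_con hP hx hv] at h1
  have h2 : -P.con m x z + inner ℝ ζ (v - z) ≤ -P.con m x v := by exact_mod_cast h1
  linarith

variable {D0 : ℝ} {D B : Fin M → ℝ}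

theorem obj_sub_le (hP : P.Standing) (hB : P.BoundedSubdiff D0 D B) {x y : Vec N} (hx : x ∈ P.X)
    (hy : y ∈ P.X) : P.obj x - P.obj y ≤ D0 * ‖x - y‖ := by
  obtain ⟨ξ, hξ⟩ := hB.f0_nonempty x hx
  have h1 := obj_subgrad hP hx hy hξ
  have h2 := real_inner_le_norm (-ξ) (y - x)
  have h3 := mul_le_mul_of_nonneg_right (hB.f0_bound x hx ξ hξ) (norm_nonneg (x - y))
  rw [norm_neg, norm_sub_rev y x, inner_neg_left] at h2
  linarith

theorem con_sub_le (hP : P.Standing) (hB : P.BoundedSubdiff D0 D B) {m : Fin M} {x y : Vec N}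
    (hx : x ∈ P.X) (hy : y ∈ P.X) {z : Vec (J m)} (hz : z ∈ P.Z m) :
    P.con m x z - P.con m y z ≤ D m * ‖x - y‖ := by
  obtain ⟨ξ, hξ⟩ := hB.gx_nonempty m x hx z hz
  have h1 := con_subgrad hP hx hy hz hξ
  have h2 := real_inner_le_norm (-ξ) (y - x)
  have h3 := mul_le_mul_of_nonneg_right (hB.gx_bound m x hx z hz ξ hξ) (norm_nonneg (x - y))
  rw [norm_neg, norm_sub_rev y x, inner_neg_left] at h2
  linarith

/-- The supergradient is taken at `v`, the subtracted point, because concavity gives upper bounds.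
Exchanging the points yields the Lipschitz property. -/
theorem con_sub_le' (hP : P.Standing) (hB : P.BoundedSubdiff D0 D B) {m : Fin M} {x : Vec N}
    (hx : x ∈ P.X) {z v : Vec (J m)} (hz : z ∈ P.Z m) (hv : v ∈ P.Z m) :
    P.con m x z - P.con m x v ≤ B m * ‖z - v‖ := by
  obtain ⟨ζ, hζ⟩ := hB.gz_nonempty m x hx v hv
  have h1 := con_supergrad hP hx hv hz hζ
  have h2 := real_inner_le_norm (-ζ) (z - v)
  have h3 := mul_le_mul_of_nonneg_right (hB.gz_bound m x hx v hv ζ hζ) (norm_nonneg (z - v))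
  rw [norm_neg, inner_neg_left] at h2
  linarith

/-- Bounded supergradients make `g m x` Lipschitz on the compact set `Z m`, so the supremum is
attained. No semicontinuity assumption is needed. -/
theorem exists_worst_eq (hP : P.Standing) (hB : P.BoundedSubdiff D0 D B) (m : Fin M) {x : Vec N}
    (hx : x ∈ P.X) : ∃ z ∈ P.Z m, P.worst m x = P.g m x z ∧ P.wc m x = P.con m x z := by
  have hcont : ContinuousOn (P.con m x) (P.Z m) := by
    refine (LipschitzOnWith.of_dist_le_mul (K := ⟨B m, (hB.B_pos m).le⟩) ?_).continuousOn
    intro z hz v hv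
    rw [Real.dist_eq, dist_eq_norm, abs_le]
    have h1 := con_sub_le' hP hB hx hz hv
    have h2 := con_sub_le' hP hB hx hv hz
    rw [norm_sub_rev] at h2
    constructor
    · change -(B m * ‖z - v‖) ≤ _; linarith
    · exact h1
  obtain ⟨z, hz, hmax⟩ := (hP.Z_compact m).exists_isMaxOn (hP.Z_nonempty m) hcont
  have h : P.worst m x = P.g m x z := by
    refine le_antisymm (iSup₂_le fun v hv => ?_) (le_iSup₂ (f := fun v _ => P.g m x v) z hz)
    rw [← coe_con hP hx hz, ← coe_con hP hx hv]
    exact_mod_cast hmax hv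
  exact ⟨z, hz, h, by rw [wc, h, con]⟩

theorem coe_wc (hP : P.Standing) (hB : P.BoundedSubdiff D0 D B) (m : Fin M) {x : Vec N}
    (hx : x ∈ P.X) : ((P.wc m x : ℝ) : EReal) = P.worst m x := by
  obtain ⟨z, hz, h1, h2⟩ := exists_worst_eq hP hB m hx
  rw [h1, h2, coe_con hP hx hz]

theorem con_le_wc (hP : P.Standing) (hB : P.BoundedSubdiff D0 D B) {m : Fin M} {x : Vec N}
    (hx : x ∈ P.X) {z : Vec (J m)} (hz : z ∈ P.Z m) : P.con m x z ≤ P.wc m x := by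
  have h : P.g m x z ≤ P.worst m x := le_iSup₂ (f := fun v _ => P.g m x v) z hz
  rw [← coe_wc hP hB m hx, ← coe_con hP hx hz] at h
  exact_mod_cast h

theorem wc_sub_le (hP : P.Standing) (hB : P.BoundedSubdiff D0 D B) {m : Fin M} {x y : Vec N}
    (hx : x ∈ P.X) (hy : y ∈ P.X) : P.wc m x - P.wc m y ≤ D m * ‖x - y‖ := by
  obtain ⟨z, hz, -, h⟩ := exists_worst_eq hP hB m hx
  have h1 := con_sub_le hP hB hx hy hz
  have h2 := con_le_wc hP hB hy hz
  linarith

theorem isApproxMaximiser_iff (hP : P.Standing) (hB : P.BoundedSubdiff D0 D B) {m : Fin M}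
    {x : Vec N} (hx : x ∈ P.X) {z : Vec (J m)} (hz : z ∈ P.Z m) (θ : ℝ) :
    P.IsApproxMaximiser θ x m z ↔ P.wc m x ≤ P.con m x z + θ := by
  rw [IsApproxMaximiser, ← coe_wc hP hB m hx, ← coe_con hP hx hz]
  simp only [hz, true_and]
  exact_mod_cast Iff.rfl

/-- Worst-case constraint functions have subgradients. -/
theorem exists_wc_subgrad (hP : P.Standing) (hB : P.BoundedSubdiff D0 D B) (m : Fin M) {x : Vec N}
    (hx : x ∈ P.X) : ∃ ξ : Vec N, ∀ y ∈ P.X, P.wc m x + inner ℝ ξ (y - x) ≤ P.wc m y := by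
  obtain ⟨z, hz, -, h⟩ := exists_worst_eq hP hB m hx
  obtain ⟨ξ, hξ⟩ := hB.gx_nonempty m x hx z hz
  refine ⟨ξ, fun y hy => ?_⟩
  rw [h]
  exact (con_subgrad hP hx hy hz hξ).trans (con_le_wc hP hB hy hz)

theorem exists_diam_bound {n : ℕ} {S : Set (Vec n)} (hS : IsCompact S) :
    ∃ d : ℝ, 0 ≤ d ∧ ∀ x ∈ S, ∀ y ∈ S, ‖x - y‖ ≤ d := by
  obtain ⟨C, hC⟩ := Metric.isBounded_iff.1 hS.isBounded
  refine ⟨max C 0, le_max_right _ _, fun x hx y hy => ?_⟩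
  rw [← dist_eq_norm]
  exact (hC hx hy).trans (le_max_left _ _)

/-- Lipschitz bounds in both variables and finite diameters reduce everything to one anchor point;
summing over `m` makes the bound uniform. -/
theorem exists_con_bound (hP : P.Standing) (hB : P.BoundedSubdiff D0 D B) :
    ∃ A : ℝ, 0 ≤ A ∧ ∀ m, ∀ x ∈ P.X, ∀ z ∈ P.Z m, |P.con m x z| ≤ A := by
  obtain ⟨dX, hdX0, hdX⟩ := exists_diam_bound hP.X_compact
  choose dZ hdZ0 hdZ using fun m => exists_diam_bound (hP.Z_compact m)
  obtain ⟨x0, hx0⟩ := hP.X_nonempty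
  choose z0 hz0 using hP.Z_nonempty
  have h0 : ∀ m, 0 ≤ |P.con m x0 (z0 m)| + D m * dX + B m * dZ m := fun m =>
    add_nonneg (add_nonneg (abs_nonneg _) (mul_nonneg (hB.D_pos m).le hdX0))
      (mul_nonneg (hB.B_pos m).le (hdZ0 m))
  refine ⟨∑ m, (|P.con m x0 (z0 m)| + D m * dX + B m * dZ m), Finset.sum_nonneg fun m _ => h0 m,
    fun m x hx z hz => ?_⟩
  refine le_trans ?_ (Finset.single_le_sum (fun m _ => h0 m) (Finset.mem_univ m))
  have a1 := con_sub_le hP hB hx hx0 hz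
  have a2 := con_sub_le hP hB hx0 hx hz
  have b1 := con_sub_le' hP hB hx0 hz (hz0 m)
  have b2 := con_sub_le' hP hB hx0 (hz0 m) hz
  have c1 := mul_le_mul_of_nonneg_left (hdX x hx x0 hx0) (hB.D_pos m).le
  have c2 := mul_le_mul_of_nonneg_left (hdZ m z hz (z0 m) (hz0 m)) (hB.B_pos m).le
  rw [norm_sub_rev] at a2 b2
  rw [abs_le]
  have d1 := neg_abs_le (P.con m x0 (z0 m))
  have d2 := le_abs_self (P.con m x0 (z0 m))
  constructor <;> linarith

end RobustProblem

/-! ### The inner algorithm: potential decrease and the strong approximate saddle point. -/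

namespace RobustProblem

variable {N M : ℕ} {J : Fin M → ℕ} {P : RobustProblem N M J} {D0 : ℝ} {D B : Fin M → ℝ}

theorem inner_ge_neg_mul {n : ℕ} {a b : Vec n} {c : ℝ} (ha : ‖a‖ ≤ c) :
    -(c * ‖b‖) ≤ inner ℝ a b := by
  have h := real_inner_le_norm (-a) b
  rw [norm_neg, inner_neg_left] at h
  have := mul_le_mul_of_nonneg_right ha (norm_nonneg b)
  linarith

theorem inner_le_mul {n : ℕ} {a b : Vec n} {c : ℝ} (ha : ‖a‖ ≤ c) : inner ℝ a b ≤ c * ‖b‖ :=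
  (real_inner_le_norm a b).trans (mul_le_mul_of_nonneg_right ha (norm_nonneg b))

/-- Completing the square. The negative squared displacement of a proximal step thus absorbs every
error linear in the displacement, at a cost proportional to the step size `h`. -/
theorem mul_sub_sq_div_le (a r : ℝ) {h : ℝ} (hh : 0 < h) :
    a * r - 1 / (2 * h) * r ^ 2 ≤ a ^ 2 * h / 2 := by
  have h1 : a ^ 2 * h / 2 - (a * r - 1 / (2 * h) * r ^ 2) = (a * h - r) ^ 2 / (2 * h) := by
    field_simp; ring
  have h2 : 0 ≤ (a * h - r) ^ 2 / (2 * h) := by positivity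
  linarith

theorem _root_.List.sum_map_finset_sum {ι κ : Type*} (l : List ι) (s : Finset κ)
    (f : ι → κ → ℝ) :
    (l.map fun i => ∑ k ∈ s, f i k).sum = ∑ k ∈ s, (l.map fun i => f i k).sum := by
  induction l with
  | nil => simp
  | cons i l ih => simp [ih, Finset.sum_add_distrib]

/-- The subgradient belongs to the old point `x`, while the value is needed at the new point `x'`.
Moving the value and moving the base point of the inner product each cost `D0 * ‖x' - x‖`. -/
theorem obj_sub_le_inner (hP : P.Standing) (hB : P.BoundedSubdiff D0 D B) {x x' u ξ : Vec N}
    (hx : x ∈ P.X) (hx' : x' ∈ P.X) (hu : u ∈ P.X) (hξ : ξ ∈ subdiff P.f0 x) :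
    P.obj x' - P.obj u ≤ inner ℝ ξ (x' - u) + 2 * D0 * ‖x' - x‖ := by
  have h1 := obj_subgrad hP hx hu hξ
  have h2 := obj_sub_le hP hB hx' hx
  have h3 := inner_ge_neg_mul (b := x' - x) (hB.f0_bound x hx ξ hξ)
  have h4 : x' - u = (x' - x) - (u - x) := by abel
  rw [h4, inner_sub_right]
  linarith

theorem con_sub_le_inner (hP : P.Standing) (hB : P.BoundedSubdiff D0 D B) {m : Fin M}
    {x x' u ξ : Vec N} {z : Vec (J m)} (hx : x ∈ P.X) (hx' : x' ∈ P.X) (hu : u ∈ P.X)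
    (hz : z ∈ P.Z m) (hξ : ξ ∈ subdiff (fun y => P.g m y z) x) :
    P.con m x' z - P.con m u z ≤ inner ℝ ξ (x' - u) + 2 * D m * ‖x' - x‖ := by
  have h1 := con_subgrad hP hx hu hz hξ
  have h2 := con_sub_le hP hB hx' hx hz
  have h3 := inner_ge_neg_mul (b := x' - x) (hB.gx_bound m x hx z hz ξ hξ)
  have h4 : x' - u = (x' - x) - (u - x) := by abel
  rw [h4, inner_sub_right]
  linarith

/-- One extrapolated dual step of the inner algorithm. -/
theorem dual_step (hP : P.Standing) (hB : P.BoundedSubdiff D0 D B) {m : Fin M} {δ lam Λ : ℝ}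
    (hδ : 0 < δ) (hlam : 0 ≤ lam) (hΛ : lam ≤ Λ) {x x' : Vec N} (hx : x ∈ P.X) (hx' : x' ∈ P.X)
    {z z' v ζ ζp : Vec (J m)} (hz : z ∈ P.Z m) (hv : v ∈ P.Z m)
    (hζ : ζ ∈ subdiff (fun y => -P.g m x y) z) (hζp : ‖ζp‖ ≤ B m)
    (hz' : IsProj (P.Z m) (z - (δ * lam) • ((2 : ℝ) • ζ - ζp)) z') :
    lam * (P.con m x' v - P.con m x' z') +
        (1 / (2 * δ) * ‖v - z'‖ ^ 2 + lam * inner ℝ ζ (z' - v)) ≤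
      1 / (2 * δ) * ‖v - z‖ ^ 2 + lam * inner ℝ ζp (z - v) + 2 * Λ * D m * ‖x' - x‖ +
        9 / 2 * (Λ * B m) ^ 2 * δ := by
  have hζB := hB.gz_bound m x hx z hz ζ hζ
  have h1 := hz'.three_point (hP.Z_convex m) hv
  rw [real_inner_smul_left] at h1
  have h1' : lam * inner ℝ ((2 : ℝ) • ζ - ζp) (z' - v) ≤
      1 / (2 * δ) * (‖v - z‖ ^ 2 - ‖v - z'‖ ^ 2 - ‖z' - z‖ ^ 2) := by
    rw [div_mul_eq_mul_div, le_div_iff₀ (by positivity)]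
    linarith
  -- The effect of extrapolation: the pairings with `z' - v` and `z - v` telescope between
  -- iterations, `ζ` against `v - z` is what concavity needs, and the two pairings with `z' - z` are
  -- errors of size `B m * ‖z' - z‖`.
  have e1 : inner ℝ ((2 : ℝ) • ζ - ζp) (z' - v) = inner ℝ ζ (z' - v) + inner ℝ ζ (z' - z) -
      inner ℝ ζp (z' - z) - inner ℝ ζp (z - v) - inner ℝ ζ (v - z) := by
    simp only [inner_sub_left, inner_sub_right, real_inner_smul_left]
    ring
  have h2 := con_supergrad hP hx hz hv hζ
  have h3 := con_sub_le hP hB hx' hx hv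
  have h4 := con_sub_le hP hB hx hx' hz
  have h5 := con_sub_le' hP hB hx' hz hz'.1
  have h6 := inner_ge_neg_mul (b := z' - z) hζB
  have h7 := inner_le_mul (b := z' - z) hζp
  rw [norm_sub_rev] at h4 h5
  have h8 : P.con m x' v - P.con m x' z' ≤ inner ℝ ((2 : ℝ) • ζ - ζp) (z' - v) -
      inner ℝ ζ (z' - v) + inner ℝ ζp (z - v) + 2 * D m * ‖x' - x‖ + 3 * B m * ‖z' - z‖ := by
    rw [e1]; linarith
  have h9 := mul_le_mul_of_nonneg_left h8 hlam
  -- The factor 3 counts the two pairings with `z' - z` from `e1` and the Lipschitz bound between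
  -- `z` and `z'`.
  have h10 := mul_sub_sq_div_le (3 * (Λ * B m)) ‖z' - z‖ hδ
  have h11 := mul_le_mul_of_nonneg_right hΛ
    (mul_nonneg (hB.D_pos m).le (norm_nonneg (x' - x)))
  have h12 := mul_le_mul_of_nonneg_right hΛ
    (mul_nonneg (hB.B_pos m).le (norm_nonneg (z' - z)))
  linarith

/-- One primal step of the inner algorithm. -/
theorem primal_step (hP : P.Standing) (hB : P.BoundedSubdiff D0 D B) {α γ Λ : ℝ} (hα : 0 < α)
    (hγ : 0 < γ) {lam : Fin M → ℝ} (hlam : ∀ m, 0 ≤ lam m) (hΛ : ∀ m, lam m ≤ Λ)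
    {xk x x' u ξ0 : Vec N} {ξ : Fin M → Vec N} (hx : x ∈ P.X) (hu : u ∈ P.X)
    {z' : (m : Fin M) → Vec (J m)} (hz' : ∀ m, z' m ∈ P.Z m) (hξ0 : ξ0 ∈ subdiff P.f0 x)
    (hξ : ∀ m, ξ m ∈ subdiff (fun y => P.g m y (z' m)) x)
    (hx' : IsProj P.X ((α * γ / (α + γ)) •
      ((1 / α) • xk + (1 / γ) • x - (ξ0 + ∑ m, lam m • ξ m))) x') :
    P.obj x' - P.obj u + ∑ m, lam m * (P.con m x' (z' m) - P.con m u (z' m)) +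
        1 / (2 * α) * ‖x' - xk‖ ^ 2 - 1 / (2 * α) * ‖u - xk‖ ^ 2 + 1 / (2 * α) * ‖u - x'‖ ^ 2 +
        1 / (2 * γ) * ‖u - x'‖ ^ 2 ≤
      1 / (2 * γ) * ‖u - x‖ ^ 2 - 1 / (2 * γ) * ‖x' - x‖ ^ 2 +
        (2 * D0 + ∑ m, 2 * Λ * D m) * ‖x' - x‖ := by
  have h1 := hx'.prox_three_point hP.X_convex hα hγ hu
  have h2 := obj_sub_le_inner hP hB hx hx'.1 hu hξ0
  have h3 : ∑ m, lam m * (P.con m x' (z' m) - P.con m u (z' m)) ≤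
      ∑ m, lam m * inner ℝ (ξ m) (x' - u) + (∑ m, 2 * Λ * D m) * ‖x' - x‖ := by
    rw [Finset.sum_mul, ← Finset.sum_add_distrib]
    refine Finset.sum_le_sum fun m _ => ?_
    have h4 := mul_le_mul_of_nonneg_left
      (con_sub_le_inner hP hB hx hx'.1 hu (hz' m) (hξ m)) (hlam m)
    have h5 := mul_le_mul_of_nonneg_right (hΛ m)
      (mul_nonneg (hB.D_pos m).le (norm_nonneg (x' - x)))
    linarith
  rw [inner_add_left, sum_inner] at h1
  simp only [real_inner_smul_left] at h1
  linarith

/-- The contribution of the iterate `p` to the primal-dual gap of the inner problem. -/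
noncomputable def gap (P : RobustProblem N M J) (α : ℝ) (lam : Fin M → ℝ) (xk u : Vec N)
    (v : (m : Fin M) → Vec (J m)) (p : Vec N × ((m : Fin M) → Vec (J m))) : ℝ :=
  P.innerObj α lam xk p.1 v - P.innerObj α lam xk u p.2 + 1 / (2 * α) * ‖u - p.1‖ ^ 2

/-- The potential of the inner algorithm. -/
noncomputable def innerPotential (γ δ : ℝ) (lam : Fin M → ℝ) (u : Vec N)
    (v : (m : Fin M) → Vec (J m)) (x : Vec N) (z ζ : (m : Fin M) → Vec (J m)) : ℝ :=
  1 / (2 * γ) * ‖u - x‖ ^ 2 +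
    ∑ m, (1 / (2 * δ) * ‖v m - z m‖ ^ 2 + lam m * inner ℝ (ζ m) (z m - v m))

/-- The error made in one iteration of the inner algorithm. -/
noncomputable def innerError (D0 : ℝ) (D B : Fin M → ℝ) (Λ γ δ : ℝ) : ℝ :=
  (2 * D0 + ∑ m, 4 * Λ * D m) ^ 2 * γ / 2 + ∑ m, 9 / 2 * (Λ * B m) ^ 2 * δ

/-- Primal and dual steps add up: the coupling terms at `z'` cancel. Both leave `2 * Λ * D m` times
`‖x' - x‖`, whence the factor 4 in `innerError`, and the primal square absorbs the total. -/
theorem inner_step (hP : P.Standing) (hB : P.BoundedSubdiff D0 D B) {α γ δ Λ : ℝ} (hα : 0 < α)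
    (hγ : 0 < γ) (hδ : 0 < δ) {lam : Fin M → ℝ} (hlam : ∀ m, 0 ≤ lam m) (hΛ : ∀ m, lam m ≤ Λ)
    {xk x x' u ξ0 : Vec N} {ξ : Fin M → Vec N} (hx : x ∈ P.X) (hu : u ∈ P.X)
    {z z' v ζ ζp : (m : Fin M) → Vec (J m)} (hz : ∀ m, z m ∈ P.Z m) (hv : ∀ m, v m ∈ P.Z m)
    (hζ : ∀ m, ζ m ∈ subdiff (fun y => -P.g m x y) (z m)) (hζp : ∀ m, ‖ζp m‖ ≤ B m)
    (hz' : ∀ m, IsProj (P.Z m) (z m - (δ * lam m) • ((2 : ℝ) • ζ m - ζp m)) (z' m))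
    (hξ0 : ξ0 ∈ subdiff P.f0 x) (hξ : ∀ m, ξ m ∈ subdiff (fun y => P.g m y (z' m)) x)
    (hx' : IsProj P.X ((α * γ / (α + γ)) •
      ((1 / α) • xk + (1 / γ) • x - (ξ0 + ∑ m, lam m • ξ m))) x') :
    P.gap α lam xk u v (x', z') + innerPotential γ δ lam u v x' z' ζ ≤
      innerPotential γ δ lam u v x z ζp + innerError D0 D B Λ γ δ := by
  have h1 := primal_step hP hB hα hγ hlam hΛ hx hu (fun m => (hz' m).1) hξ0 hξ hx'
  have h2 := Finset.sum_le_sum fun m (_ : m ∈ Finset.univ) =>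
    dual_step hP hB hδ (hlam m) (hΛ m) hx hx'.1 (hz m) (hv m) (hζ m) (hζp m) (hz' m)
  have h3 := mul_sub_sq_div_le (2 * D0 + ∑ m, 4 * Λ * D m) ‖x' - x‖ hγ
  have e1 : ∑ m, 4 * Λ * D m = 2 * ∑ m, 2 * Λ * D m := by
    rw [Finset.mul_sum]; exact Finset.sum_congr rfl fun m _ => by ring
  have e2 : P.gap α lam xk u v (x', z') = P.obj x' - P.obj u +
      ∑ m, lam m * (P.con m x' (z' m) - P.con m u (z' m)) +
      ∑ m, lam m * (P.con m x' (v m) - P.con m x' (z' m)) +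
      1 / (2 * α) * ‖x' - xk‖ ^ 2 - 1 / (2 * α) * ‖u - xk‖ ^ 2 +
      1 / (2 * α) * ‖u - x'‖ ^ 2 := by
    have : ∑ m, lam m * (P.con m x' (z' m) - P.con m u (z' m)) +
        ∑ m, lam m * (P.con m x' (v m) - P.con m x' (z' m)) =
        ∑ m, lam m * P.con m x' (v m) - ∑ m, lam m * P.con m u (z' m) := by
      rw [← Finset.sum_add_distrib, ← Finset.sum_sub_distrib]
      exact Finset.sum_congr rfl fun m _ => by ring
    rw [add_assoc (P.obj x' - P.obj u), this]
    simp only [gap, innerObj, obj, con]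
    ring
  rw [e2]
  simp only [innerPotential, innerError, Finset.sum_add_distrib] at h2 ⊢
  rw [e1] at h3 ⊢
  rw [← Finset.sum_mul (f := fun m => 2 * Λ * D m)] at h2
  linarith

/-- What the inner loop guarantees about its output. -/
def InnerHistory (P : RobustProblem N M J) (α : ℝ) (lam : Fin M → ℝ) (xk : Vec N) (n : ℕ)
    (R : ℝ) (sx : Vec N) (sz : (m : Fin M) → Vec (J m))
    (l : List (Vec N × ((m : Fin M) → Vec (J m)))) (pot : Vec N → ((m : Fin M) → Vec (J m)) → ℝ) :
    Prop :=
  l.length = n ∧ sx = (l.map Prod.fst).sum ∧ (∀ m, sz m = (l.map fun p => p.2 m).sum) ∧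
    (∀ p ∈ l, p.1 ∈ P.X ∧ ∀ m, p.2 m ∈ P.Z m) ∧
    ∀ u ∈ P.X, ∀ v : (m : Fin M) → Vec (J m), (∀ m, v m ∈ P.Z m) →
      (l.map (P.gap α lam xk u v)).sum + pot u v ≤ R

/-- The invariant is required for every bounded `ζ` since the first iteration has no previous
subgradient and substitutes the one it is about to receive. At the end, the potential is dropped:
its squares are nonnegative and its inner products are at least `-Λ * (B m * dZ m)`. -/
theorem innerLoop_ensures (hP : P.Standing) (hB : P.BoundedSubdiff D0 D B) {α γ δ Λ : ℝ}
    (hα : 0 < α) (hγ : 0 < γ) (hδ : 0 < δ) {lam : Fin M → ℝ} (hlam : ∀ m, 0 ≤ lam m)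
    (hΛ : ∀ m, lam m ≤ Λ) (xk : Vec N) {dZ : Fin M → ℝ}
    (hdZ : ∀ m, ∀ z ∈ P.Z m, ∀ v ∈ P.Z m, ‖z - v‖ ≤ dZ m) (R : ℝ) (t : ℕ) :
    ∀ (n : ℕ) (x : Vec N) (z : (m : Fin M) → Vec (J m))
      (ζp : Option ((m : Fin M) → Vec (J m))) (sx : Vec N) (sz : (m : Fin M) → Vec (J m))
      (l : List (Vec N × ((m : Fin M) → Vec (J m)))),
      x ∈ P.X → (∀ m, z m ∈ P.Z m) → (∀ ζ ∈ ζp, ∀ m, ‖ζ m‖ ≤ B m) →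
      (∀ ζ : (m : Fin M) → Vec (J m), (∀ m, ‖ζ m‖ ≤ B m) →
        P.InnerHistory α lam xk n (R + n * innerError D0 D B Λ γ δ) sx sz l
          fun u v => innerPotential γ δ lam u v x z (ζp.getD ζ)) →
      (innerLoop α γ δ lam xk t x z ζp sx sz).Ensures P fun r c =>
        (∃ l, P.InnerHistory α lam xk (n + t)
          (R + (n + t : ℕ) * innerError D0 D B Λ γ δ + ∑ m, Λ * (B m * dZ m)) r.1 r.2 l
          fun _ _ => 0) ∧ c = t * (3 * M + 2) := by
  induction t with
  | zero =>
    intro n x z ζp sx sz l hx hz hζp hinv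
    refine ⟨⟨l, ?_⟩, by simp⟩
    obtain ⟨z0, hz0⟩ : ∃ ζ : (m : Fin M) → Vec (J m), ∀ m, ‖ζ m‖ ≤ B m :=
      ⟨fun _ => 0, fun m => by simpa using (hB.B_pos m).le⟩
    obtain ⟨h1, h2, h3, h4, h5⟩ := hinv z0 hz0
    refine ⟨h1, h2, h3, h4, fun u hu v hv => ?_⟩
    have h6 := h5 u hu v hv
    have hb : ∀ m, ‖(ζp.getD z0) m‖ ≤ B m := by
      cases ζp with
      | none => exact hz0
      | some ζ => exact hζp ζ rfl
    have h7 : -∑ m, Λ * (B m * dZ m) ≤ innerPotential γ δ lam u v x z (ζp.getD z0) := by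
      rw [innerPotential, ← Finset.sum_neg_distrib]
      refine le_add_of_nonneg_of_le (by positivity) (Finset.sum_le_sum fun m _ => ?_)
      refine le_add_of_nonneg_of_le (by positivity) ?_
      have h8 := inner_ge_neg_mul (b := z m - v m) (hb m)
      have h9 := mul_le_mul_of_nonneg_left (hdZ m _ (hz m) _ (hv m)) (hB.B_pos m).le
      have h10 : 0 ≤ B m * dZ m :=
        le_trans (mul_nonneg (hB.B_pos m).le (norm_nonneg _)) h9
      have h11 := mul_le_mul_of_nonneg_right (hΛ m) h10
      have h12 := mul_le_mul_of_nonneg_left 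
        (show -(B m * dZ m) ≤ inner ℝ ((ζp.getD z0) m) (z m - v m) by linarith) (hlam m)
      linarith
    simp only [add_zero]
    linarith
  | succ t ih =>
    intro n x z ζp sx sz l hx hz hζp hinv
    refine ⟨fun m => hB.gz_nonempty m x hx (z m) (hz m), fun ζ hζ => ?_⟩
    refine ⟨fun m => exists_isProj (hP.Z_nonempty m) (hP.Z_compact m) _, fun z' hz' => ?_⟩
    have hz'Z : ∀ m, z' m ∈ P.Z m := fun m => (hz' m).1
    refine ⟨fun _ => hB.f0_nonempty x hx, fun ξ0 hξ0 => ?_⟩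
    refine ⟨fun m => hB.gx_nonempty m x hx (z' m) (hz'Z m), fun ξ hξ => ?_⟩
    refine ⟨fun _ => exists_isProj hP.X_nonempty hP.X_compact _, fun x' hx' => ?_⟩
    have hζB : ∀ m, ‖ζ m‖ ≤ B m := fun m => hB.gz_bound m x hx (z m) (hz m) (ζ m) (hζ m)
    have hb : ∀ m, ‖(ζp.getD ζ) m‖ ≤ B m := by
      cases ζp with
      | none => exact hζB
      | some ζ => exact hζp ζ rfl
    obtain ⟨h1, h2, h3, h4, h5⟩ := hinv ζ hζB
    refine (ih (n + 1) (x' 0) z' (some ζ) _ _ ((x' 0, z') :: l) (hx' 0).1 hz'Z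
      (fun ζ' h => by cases h; exact hζB) fun ζ' _ => ?_).mono ?_
    · refine ⟨by simp [h1], by simp [h2, add_comm], fun m => by simp [h3, add_comm], ?_, ?_⟩
      · intro p hp
        rcases List.mem_cons.1 hp with rfl | hp
        · exact ⟨(hx' 0).1, hz'Z⟩
        · exact h4 p hp
      · intro u hu v hv
        have h6 := h5 u hu v hv
        have h7 := inner_step hP hB hα hγ hδ hlam hΛ hx hu hz hv hζ hb hz' (hξ0 0) hξ (hx' 0)
        simp only [List.map_cons, List.sum_cons, Option.getD_some, Nat.cast_add, Nat.cast_one]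
        linarith
    · rintro r c ⟨hr, hc⟩
      rw [show n + 1 + t = n + (t + 1) by ring] at hr
      refine ⟨hr, ?_⟩
      simp [Request.calls, hc]
      ring

/-- The constant in the `1 / √T` rate of the inner algorithm. -/
noncomputable def innerConst (D0 : ℝ) (D B : Fin M → ℝ) (Λ dX : ℝ) (dZ : Fin M → ℝ) : ℝ :=
  dX ^ 2 / 2 + ∑ m, dZ m ^ 2 / 2 + 2 * ∑ m, Λ * (B m * dZ m) + innerError D0 D B Λ 1 1

/-- The gap is convex in the iterate even with the added `‖u - x‖²` term, so Jensen applies to each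
summand separately; that term is what makes the saddle point strong. -/
theorem IsStrongApproxSaddle.of_history (hP : P.Standing) (hB : P.BoundedSubdiff D0 D B)
    {α ν R : ℝ} (hα : 0 < α) {lam : Fin M → ℝ} (hlam : ∀ m, 0 ≤ lam m) {xk : Vec N} {T : ℕ}
    (hT : 0 < T) {sx : Vec N} {sz : (m : Fin M) → Vec (J m)}
    {l : List (Vec N × ((m : Fin M) → Vec (J m)))}
    (h : P.InnerHistory α lam xk T R sx sz l fun _ _ => 0) (hν : R ≤ T * ν) :
    P.IsStrongApproxSaddle α ν lam xk ((1 / (T : ℝ)) • sx) fun m => (1 / (T : ℝ)) • sz m := by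
  obtain ⟨h1, h2, h3, h4, h5⟩ := h
  have hl : l ≠ [] := by rintro rfl; simp at h1; omega
  have hTr : (0 : ℝ) < T := by exact_mod_cast hT
  have hxX : (1 / (T : ℝ)) • sx ∈ P.X := by
    rw [h2, ← h1]; exact average_mem hP.X_convex l _ (fun p hp => (h4 p hp).1) hl
  have hzZ : ∀ m, (1 / (T : ℝ)) • sz m ∈ P.Z m := fun m => by
    rw [h3, ← h1]; exact average_mem (hP.Z_convex m) l _ (fun p hp => (h4 p hp).2 m) hl
  refine ⟨hxX, hzZ, fun u hu v hv => ?_⟩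
  have hx : (l.length : ℝ) • ((1 / (T : ℝ)) • sx) = (l.map Prod.fst).sum := by
    rw [h1, smul_smul, mul_one_div_cancel hTr.ne', one_smul, h2]
  have hz : ∀ m, (l.length : ℝ) • ((1 / (T : ℝ)) • sz m) = (l.map fun p => p.2 m).sum :=
    fun m => by rw [h1, smul_smul, mul_one_div_cancel hTr.ne', one_smul, h3]
  set xh := (1 / (T : ℝ)) • sx with hxh
  have e1 : ∀ (c : ℝ) (y : Vec N), (l.length : ℝ) * (c * ‖xh - y‖ ^ 2) ≤
      (l.map fun p => c * ‖p.1 - y‖ ^ 2).sum ∨ c < 0 := by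
    intro c y
    rcases lt_or_ge c 0 with hc | hc
    · exact Or.inr hc
    refine Or.inl (length_mul_le_sum_of_subgradient l Prod.fst (fun x => c * ‖x - y‖ ^ 2)
      -- The gradient of `c * ‖x - y‖ ^ 2` at the average.
      (ξ := (2 * c) • (xh - y)) (fun p _ => ?_) hx)
    have e : p.1 - y = (xh - y) + (p.1 - xh) := by abel
    rw [e, norm_add_sq_real, real_inner_smul_left]
    have := mul_nonneg hc (sq_nonneg ‖p.1 - xh‖)
    linarith
  have hc : (0 : ℝ) ≤ 1 / (2 * α) := by positivity
  have q1 := (e1 (1 / (2 * α)) xk).resolve_right (not_lt.2 hc)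
  have q2 := (e1 (1 / (2 * α)) u).resolve_right (not_lt.2 hc)
  have q3 : l.length * P.obj xh ≤ (l.map fun p => P.obj p.1).sum := by
    obtain ⟨ξ, hξ⟩ := hB.f0_nonempty xh hxX
    exact length_mul_le_sum_of_subgradient l Prod.fst P.obj
      (fun p hp => obj_subgrad hP hxX (h4 p hp).1 hξ) hx
  have q4 : ∀ m, l.length * P.con m xh (v m) ≤ (l.map fun p => P.con m p.1 (v m)).sum := by
    intro m
    obtain ⟨ξ, hξ⟩ := hB.gx_nonempty m xh hxX (v m) (hv m)
    exact length_mul_le_sum_of_subgradient l Prod.fst (fun x => P.con m x (v m))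
      (fun p hp => con_subgrad hP hxX (h4 p hp).1 (hv m) hξ) hx
  have q5 : ∀ m, l.length * (-P.con m u ((1 / (T : ℝ)) • sz m)) ≤
      (l.map fun p => -P.con m u (p.2 m)).sum := by
    intro m
    obtain ⟨ζ, hζ⟩ := hB.gz_nonempty m u hu _ (hzZ m)
    refine length_mul_le_sum_of_subgradient l (fun p => p.2 m) (fun z => -P.con m u z)
      (ξ := ζ) (fun p hp => ?_) (hz m)
    have := con_supergrad hP hu (hzZ m) ((h4 p hp).2 m) hζ
    linarith
  have q6 : (l.length : ℝ) * ∑ m, lam m * (P.con m xh (v m) - P.con m u ((1 / (T : ℝ)) • sz m)) ≤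
      (l.map fun p => ∑ m, lam m * (P.con m p.1 (v m) - P.con m u (p.2 m))).sum := by
    rw [Finset.mul_sum, List.sum_map_finset_sum]
    refine Finset.sum_le_sum fun m _ => ?_
    rw [List.sum_map_mul_left]
    have h6 := mul_le_mul_of_nonneg_left (add_le_add (q4 m) (q5 m)) (hlam m)
    simp only [sub_eq_add_neg, List.sum_map_add]
    linarith
  have e2 : ∀ p : Vec N × ((m : Fin M) → Vec (J m)), P.gap α lam xk u v p =
      P.obj p.1 + ∑ m, lam m * (P.con m p.1 (v m) - P.con m u (p.2 m)) +
        1 / (2 * α) * ‖p.1 - xk‖ ^ 2 + 1 / (2 * α) * ‖p.1 - u‖ ^ 2 -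
        (P.obj u + 1 / (2 * α) * ‖u - xk‖ ^ 2) := by
    intro p
    simp only [gap, innerObj, mul_sub, Finset.sum_sub_distrib, obj, con, norm_sub_rev u p.1]
    ring
  have h6 := h5 u hu v hv
  have h7 : (l.map (P.gap α lam xk u v)).sum = (l.map fun p => P.obj p.1).sum +
      (l.map fun p => ∑ m, lam m * (P.con m p.1 (v m) - P.con m u (p.2 m))).sum +
      (l.map fun p => 1 / (2 * α) * ‖p.1 - xk‖ ^ 2).sum +
      (l.map fun p => 1 / (2 * α) * ‖p.1 - u‖ ^ 2).sum -
      l.length * (P.obj u + 1 / (2 * α) * ‖u - xk‖ ^ 2) := by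
    rw [funext e2]
    simp only [sub_eq_add_neg, List.sum_map_add, List.map_const', List.sum_replicate,
      nsmul_eq_mul]
    ring
  have h8 : (T : ℝ) * P.gap α lam xk u v (xh, fun m => (1 / (T : ℝ)) • sz m) ≤ T * ν := by
    rw [e2]
    rw [h1] at q1 q2 q3 q6 h7
    dsimp only at h6 ⊢
    linarith
  have h9 := le_of_mul_le_mul_left h8 hTr
  rw [gap] at h9
  have e3 : 1 / α / 2 = 1 / (2 * α) := by field_simp
  rw [e3]
  linarith

/-- With step sizes `1 / √T`, the initial squares and the accumulated errors are both of order `√T`;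
averaging divides by `T`. -/
theorem innerAlg_ensures (hP : P.Standing) (hB : P.BoundedSubdiff D0 D B) {α ν Λ : ℝ}
    (hα : 0 < α) {dX : ℝ} {dZ : Fin M → ℝ} (hdX : ∀ x ∈ P.X, ∀ y ∈ P.X, ‖x - y‖ ≤ dX)
    (hdZ : ∀ m, ∀ z ∈ P.Z m, ∀ v ∈ P.Z m, ‖z - v‖ ≤ dZ m) {T : ℕ} (hT : 0 < T)
    (hν : innerConst D0 D B Λ dX dZ * (1 / √T) ≤ ν)
    {lam : Fin M → ℝ} (hlam : ∀ m, 0 ≤ lam m) (hΛ : ∀ m, lam m ≤ Λ) (xk : Vec N) :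
    (innerAlg T α (1 / √T) (1 / √T) lam xk).Ensures P fun r c =>
      P.IsStrongApproxSaddle α ν lam xk r.1 r.2 ∧ c = T * (3 * M + 2) := by
  have hTr : (1 : ℝ) ≤ T := by exact_mod_cast hT
  set s := √(T : ℝ) with hs
  have hs1 : 1 ≤ s := Real.one_le_sqrt.2 hTr
  have hs0 : 0 < s := by linarith
  have hss : s * s = T := Real.mul_self_sqrt (by linarith)
  have hs' : 0 < 1 / s := by positivity
  choose z0 hz0 using hP.Z_nonempty
  obtain ⟨x0, hx0⟩ := hP.X_nonempty
  refine ⟨fun _ => ⟨(x0, z0), hx0, hz0⟩, fun st hst => ?_⟩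
  have hΛB : ∀ m, 0 ≤ Λ * (B m * dZ m) := fun m =>
    mul_nonneg ((hlam m).trans (hΛ m)) (mul_nonneg (hB.B_pos m).le
      ((norm_nonneg _).trans (hdZ m _ (hz0 m) _ (hz0 m))))
  refine Prog.Ensures.bind ((innerLoop_ensures hP hB hα hs' hs' hlam hΛ xk hdZ
    (s * (dX ^ 2 / 2 + ∑ m, dZ m ^ 2 / 2) + ∑ m, Λ * (B m * dZ m)) T 0 _ _ none 0 (fun _ => 0) []
    (hst 0).1 (hst 0).2 (fun _ h => by cases h) ?_).mono ?_)
  · intro ζ hζ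
    refine ⟨rfl, by simp, by simp, by simp, fun u hu v hv => ?_⟩
    simp only [List.map_nil, List.sum_nil, zero_add, Nat.cast_zero, zero_mul, add_zero,
      Option.getD_none, innerPotential]
    have e : 1 / (2 * (1 / s)) = s / 2 := by field_simp
    rw [e, mul_add, Finset.mul_sum, add_assoc, ← Finset.sum_add_distrib]
    refine add_le_add ?_ (Finset.sum_le_sum fun m _ => add_le_add ?_ ?_)
    · have := mul_le_mul_of_nonneg_left
        (pow_le_pow_left₀ (norm_nonneg _) (hdX u hu _ (hst 0).1) 2) hs0.le
      linarith
    · have := mul_le_mul_of_nonneg_left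
        (pow_le_pow_left₀ (norm_nonneg _) (hdZ m _ (hv m) _ ((hst 0).2 m)) 2) hs0.le
      linarith
    · have h1 := inner_le_mul (b := (st 0).2 m - v m) (hζ m)
      have h2 := mul_le_mul_of_nonneg_left (hdZ m _ ((hst 0).2 m) _ (hv m)) (hB.B_pos m).le
      have h3 := mul_le_mul_of_nonneg_left (h1.trans h2) (hlam m)
      have h4 : 0 ≤ B m * dZ m := mul_nonneg (hB.B_pos m).le
        ((norm_nonneg _).trans (hdZ m _ (hz0 m) _ (hz0 m)))
      exact h3.trans (mul_le_mul_of_nonneg_right (hΛ m) h4)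
  · rintro r c ⟨⟨l, hl⟩, hc⟩
    rw [zero_add] at hl
    refine ⟨IsStrongApproxSaddle.of_history hP hB hα hlam hT hl ?_, by simp [Request.calls, hc]⟩
    have e1 : innerError D0 D B Λ (1 / s) (1 / s) = innerError D0 D B Λ 1 1 * (1 / s) := by
      simp only [innerError, add_mul, Finset.sum_mul, mul_one]
      congr 1
      ring
    have e2 : (T : ℝ) * (1 / s) = s := by rw [← hss]; field_simp
    have h1 := mul_le_mul_of_nonneg_left hν (show (0 : ℝ) ≤ T by linarith)
    rw [e1]
    have e3 : ∀ a : ℝ, (T : ℝ) * (a * (1 / s)) = a * s := fun a => by rw [mul_left_comm, e2]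
    rw [e3, innerConst] at h1
    rw [e3]
    have h2 : 0 ≤ ∑ m, Λ * (B m * dZ m) := Finset.sum_nonneg fun m _ => hΛB m
    -- The inner-product terms of the initial and final potentials do not scale with `s`; as `1 ≤
    -- s`, one of the two copies in `innerConst` covers each.
    have h3 := mul_le_mul_of_nonneg_right hs1 h2
    linarith

end RobustProblem

/-! ### The maximisation step: projected subgradient ascent and exact picks. -/

namespace RobustProblem

variable {N M : ℕ} {J : Fin M → ℕ} {P : RobustProblem N M J} {D0 : ℝ} {D B : Fin M → ℝ}

theorem ascent_step (hP : P.Standing) (hB : P.BoundedSubdiff D0 D B) {m : Fin M} {s : ℝ}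
    (hs : 0 < s) {x : Vec N} (hx : x ∈ P.X) {z z' v ζ : Vec (J m)} (hz : z ∈ P.Z m)
    (hv : v ∈ P.Z m) (hζ : ζ ∈ subdiff (fun y => -P.g m x y) z)
    (hz' : IsProj (P.Z m) (z - s • ζ) z') :
    P.con m x v - P.con m x z + 1 / (2 * s) * ‖v - z'‖ ^ 2 ≤
      1 / (2 * s) * ‖v - z‖ ^ 2 + s * B m ^ 2 / 2 := by
  have h1 := hz'.three_point (hP.Z_convex m) hv
  rw [real_inner_smul_left] at h1
  have h2 : inner ℝ ζ (z' - v) ≤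
      1 / (2 * s) * (‖v - z‖ ^ 2 - ‖v - z'‖ ^ 2 - ‖z' - z‖ ^ 2) := by
    rw [div_mul_eq_mul_div, le_div_iff₀ (by positivity)]
    linarith
  have h3 := con_supergrad hP hx hz hv hζ
  have h4 := inner_ge_neg_mul (b := z' - z) (hB.gz_bound m x hx z hz ζ hζ)
  have h5 := mul_sub_sq_div_le (B m) ‖z' - z‖ hs
  have e : z' - v = (z' - z) - (v - z) := by abel
  rw [e, inner_sub_right] at h2
  linarith

/-- What the ascent loop guarantees about its output. -/
def AscentHistory (P : RobustProblem N M J) (x : Vec N) (n : ℕ) (R : Fin M → ℝ)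
    (sz : (m : Fin M) → Vec (J m)) (l : List ((m : Fin M) → Vec (J m)))
    (pot : (m : Fin M) → Vec (J m) → ℝ) : Prop :=
  l.length = n ∧ (∀ m, sz m = (l.map fun p => p m).sum) ∧ (∀ p ∈ l, ∀ m, p m ∈ P.Z m) ∧
    ∀ m, ∀ v ∈ P.Z m,
      (l.map fun p => P.con m x v - P.con m x (p m)).sum + pot m v ≤ R m

theorem ascentLoop_ensures (hP : P.Standing) (hB : P.BoundedSubdiff D0 D B) {s : ℝ} (hs : 0 < s)
    {x : Vec N} (hx : x ∈ P.X) (R : Fin M → ℝ) (t : ℕ) :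
    ∀ (n : ℕ) (z sz : (m : Fin M) → Vec (J m)) (l : List ((m : Fin M) → Vec (J m))),
      (∀ m, z m ∈ P.Z m) →
      P.AscentHistory x n (fun m => R m + n * (s * B m ^ 2 / 2)) sz l
        (fun m v => 1 / (2 * s) * ‖v - z m‖ ^ 2) →
      (ascentLoop s x t z sz).Ensures P fun r c =>
        (∃ l, P.AscentHistory x (n + t) (fun m => R m + (n + t : ℕ) * (s * B m ^ 2 / 2)) r l
          fun _ _ => 0) ∧ c = t * (2 * M) := by
  induction t with
  | zero =>
    rintro n z sz l hz ⟨h1, h2, h3, h4⟩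
    refine ⟨⟨l, h1, h2, h3, fun m v hv => ?_⟩, by simp⟩
    have h5 := h4 m v hv
    have h6 : 0 ≤ 1 / (2 * s) * ‖v - z m‖ ^ 2 := by positivity
    simp only [add_zero]
    linarith
  | succ t ih =>
    rintro n z sz l hz ⟨h1, h2, h3, h4⟩
    refine ⟨fun m => hB.gz_nonempty m x hx (z m) (hz m), fun ζ hζ => ?_⟩
    refine ⟨fun m => exists_isProj (hP.Z_nonempty m) (hP.Z_compact m) _, fun z' hz' => ?_⟩
    refine (ih (n + 1) z' _ (z :: l) (fun m => (hz' m).1) ⟨by simp [h1], fun m => by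
      simp [h2, add_comm], ?_, fun m v hv => ?_⟩).mono ?_
    · intro p hp
      rcases List.mem_cons.1 hp with rfl | hp
      · exact hz
      · exact h3 p hp
    · have h5 := h4 m v hv
      have h6 := ascent_step hP hB hs hx (hz m) hv (hζ m) (hz' m)
      simp only [List.map_cons, List.sum_cons, Nat.cast_add, Nat.cast_one]
      linarith
    · rintro r c ⟨hr, hc⟩
      rw [show n + 1 + t = n + (t + 1) by ring] at hr
      refine ⟨hr, ?_⟩
      simp [Request.calls, hc]
      ring

/-- Comparison with an exact maximiser `v`: the telescoped regret is at most `√S * (dZ m ^ 2 / 2 + B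
m ^ 2 / 2)`, and concavity transfers the mean regret to the averaged point. -/
theorem findByAscent_ensures (hP : P.Standing) (hB : P.BoundedSubdiff D0 D B) {θ : ℝ}
    {dZ : Fin M → ℝ} (hdZ : ∀ m, ∀ z ∈ P.Z m, ∀ v ∈ P.Z m, ‖z - v‖ ≤ dZ m) {S : ℕ} (hS : 0 < S)
    (hθ : ∀ m, (dZ m ^ 2 / 2 + B m ^ 2 / 2) * (1 / √S) ≤ θ) {x : Vec N} (hx : x ∈ P.X) :
    (findByAscent S (1 / √S) x).Ensures P fun z c =>
      (∀ m, P.IsApproxMaximiser θ x m (z m)) ∧ c = S * (2 * M) := by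
  have hSr : (0 : ℝ) < S := by exact_mod_cast hS
  set s := √(S : ℝ) with hs
  have hs0 : 0 < s := Real.sqrt_pos.2 hSr
  have hss : s * s = S := Real.mul_self_sqrt hSr.le
  have hs' : 0 < 1 / s := by positivity
  choose z0 hz0 using hP.Z_nonempty
  refine ⟨fun _ => ⟨(x, z0), hx, hz0⟩, fun st hst => ?_⟩
  refine Prog.Ensures.bind ((ascentLoop_ensures hP hB hs' hx (fun m => s * (dZ m ^ 2 / 2)) S 0 _
    (fun _ => 0) [] (hst 0).2 ⟨rfl, by simp, by simp, fun m v hv => ?_⟩).mono ?_)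
  · have e : 1 / (2 * (1 / s)) = s / 2 := by field_simp
    have := mul_le_mul_of_nonneg_left
      (pow_le_pow_left₀ (norm_nonneg _) (hdZ m _ hv _ ((hst 0).2 m)) 2) hs0.le
    simp only [List.map_nil, List.sum_nil, e, Nat.cast_zero]
    linarith
  · rintro r c ⟨⟨l, h1, h2, h3, h4⟩, hc⟩
    refine ⟨fun m => ?_, by simp [Request.calls, hc]⟩
    rw [zero_add] at h1
    have hl : l ≠ [] := by rintro rfl; simp at h1; omega
    have hzZ : (1 / (S : ℝ)) • r m ∈ P.Z m := by
      rw [h2, ← h1]; exact average_mem (hP.Z_convex m) l _ (fun p hp => h3 p hp m) hl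
    refine (isApproxMaximiser_iff hP hB hx hzZ θ).2 ?_
    obtain ⟨v, hv, -, hwc⟩ := exists_worst_eq hP hB m hx
    obtain ⟨ζ, hζ⟩ := hB.gz_nonempty m x hx _ hzZ
    have h5 := length_mul_le_sum_of_subgradient l (fun p => p m)
      (fun z => P.con m x v - P.con m x z) (p := (1 / (S : ℝ)) • r m) (ξ := ζ)
      (fun p hp => by
        have := con_supergrad hP hx hzZ (h3 p hp m) hζ
        linarith) (by rw [h1, smul_smul, mul_one_div_cancel hSr.ne', one_smul, h2])
    have h6 := h4 m v hv
    have h7 := mul_le_mul_of_nonneg_left (hθ m) hSr.le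
    have e2 : (S : ℝ) * (1 / s) = s := by rw [← hss]; field_simp
    rw [mul_left_comm, e2] at h7
    have e3 : (S : ℝ) * (1 / s * B m ^ 2 / 2) = s * (B m ^ 2 / 2) := by
      rw [mul_div_assoc, ← mul_assoc, e2]
    dsimp only at h6
    rw [zero_add, e3] at h6
    rw [h1] at h5
    have h8 : (S : ℝ) * (P.con m x v - P.con m x ((1 / (S : ℝ)) • r m)) ≤ S * θ := by linarith
    have h9 := le_of_mul_le_mul_left h8 hSr
    rw [hwc]
    linarith

theorem findByPick_ensures (hP : P.Standing) (hB : P.BoundedSubdiff D0 D B) {θ : ℝ} (hθ : 0 ≤ θ)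
    {x : Vec N} (hx : x ∈ P.X) :
    (findByPick (J := J) θ x).Ensures P fun z c =>
      (∀ m, P.IsApproxMaximiser θ x m (z m)) ∧ c = 0 := by
  refine ⟨fun m => ?_, fun z hz => ⟨hz, by simp [Request.calls]⟩⟩
  obtain ⟨v, hv, -, hwc⟩ := exists_worst_eq hP hB m hx
  exact ⟨v, (isApproxMaximiser_iff hP hB hx hv θ).2 (by linarith)⟩

end RobustProblem

/-! ### Lagrange multipliers from Slater's condition. -/

namespace RobustProblem

variable {N M : ℕ} {J : Fin M → ℕ} {P : RobustProblem N M J} {D0 : ℝ} {D B : Fin M → ℝ}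

/-- The two inequalities given by the subgradient at the convex combination are averaged with the
same weights, and the linear terms cancel. -/
theorem convexOn_of_exists_subgrad {n : ℕ} {S : Set (Vec n)} (hS : Convex ℝ S) {φ : Vec n → ℝ}
    (h : ∀ x ∈ S, ∃ ξ : Vec n, ∀ y ∈ S, φ x + inner ℝ ξ (y - x) ≤ φ y) : ConvexOn ℝ S φ := by
  refine ⟨hS, fun x hx y hy a b ha hb hab => ?_⟩
  obtain ⟨ξ, hξ⟩ := h _ (hS hx hy ha hb hab)
  have h1 := mul_le_mul_of_nonneg_left (hξ x hx) ha
  have h2 := mul_le_mul_of_nonneg_left (hξ y hy) hb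
  simp only [inner_sub_right, inner_add_right, real_inner_smul_right, smul_eq_mul] at h1 h2 ⊢
  obtain rfl : b = 1 - a := by linarith
  linarith

theorem convexOn_obj (hP : P.Standing) (hB : P.BoundedSubdiff D0 D B) : ConvexOn ℝ P.X P.obj :=
  convexOn_of_exists_subgrad hP.X_convex fun x hx =>
    (hB.f0_nonempty x hx).imp fun _ hξ _ hy => obj_subgrad hP hx hy hξ

theorem convexOn_wc (hP : P.Standing) (hB : P.BoundedSubdiff D0 D B) (m : Fin M) :
    ConvexOn ℝ P.X (P.wc m) :=
  convexOn_of_exists_subgrad hP.X_convex fun _ hx => exists_wc_subgrad hP hB m hx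

theorem isFeasible_iff (hP : P.Standing) (hB : P.BoundedSubdiff D0 D B) {x : Vec N} :
    P.IsFeasible x ↔ x ∈ P.X ∧ ∀ m, P.wc m x ≤ 0 := by
  refine and_congr_right fun hx => forall_congr' fun m => ?_
  rw [← coe_wc hP hB m hx]
  exact_mod_cast Iff.rfl

/-- Strict upper values of objective and constraints, relative to the objective level `c`. -/
def upperValues (P : RobustProblem N M J) (c : ℝ) : Set (ℝ × (Fin M → ℝ)) :=
  {q | ∃ x ∈ P.X, P.obj x - c < q.1 ∧ ∀ m, P.wc m x < q.2 m}

theorem isOpen_upperValues (c : ℝ) : IsOpen (P.upperValues c) := by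
  have : P.upperValues c = ⋃ x ∈ P.X, ({q : ℝ × (Fin M → ℝ) | P.obj x - c < q.1} ∩
      ⋂ m, {q : ℝ × (Fin M → ℝ) | P.wc m x < q.2 m}) := by
    ext q; simp [upperValues, and_left_comm]
  rw [this]
  refine isOpen_biUnion fun x _ => (isOpen_lt (by fun_prop) (by fun_prop)).inter
    (isOpen_iInter_of_finite fun m => isOpen_lt (by fun_prop) (by fun_prop))

theorem convex_upperValues (hP : P.Standing) (hB : P.BoundedSubdiff D0 D B) (c : ℝ) :
    Convex ℝ (P.upperValues c) := by
  rintro p ⟨x, hx, h1, h2⟩ q ⟨y, hy, h3, h4⟩ a b ha hb hab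
  have aux : ∀ s t s' t' : ℝ, s < s' → t < t' → a * s + b * t < a * s' + b * t' := by
    intro s t s' t' hs ht
    rcases ha.eq_or_lt with rfl | ha'
    · obtain rfl : b = 1 := by linarith
      linarith
    · have h5 := mul_lt_mul_of_pos_left hs ha'
      have h6 := mul_le_mul_of_nonneg_left ht.le hb
      linarith
  refine ⟨a • x + b • y, hP.X_convex hx hy ha hb hab, ?_, fun m => ?_⟩
  · have h5 := (convexOn_obj hP hB).2 hx hy ha hb hab
    have h6 := aux _ _ _ _ h1 h3
    simp only [smul_eq_mul, Prod.fst_add, Prod.smul_fst] at h5 ⊢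
    obtain rfl : b = 1 - a := by linarith
    linarith
  · have h5 := (convexOn_wc hP hB m).2 hx hy ha hb hab
    have h6 := aux _ _ _ _ (h2 m) (h4 m)
    simp only [smul_eq_mul, Prod.snd_add, Prod.smul_snd, Pi.add_apply, Pi.smul_apply] at h5 ⊢
    linarith

theorem nonneg_of_forall_add_mul_pos {a b : ℝ} (h : ∀ t : ℝ, 0 ≤ t → 0 < a + t * b) : 0 ≤ b := by
  by_contra! hb
  have h1 := h (|a| / -b) (div_nonneg (abs_nonneg a) (by linarith))
  have h2 : |a| / -b * b = -|a| := by rw [div_neg, neg_mul, div_mul_cancel₀ _ hb.ne]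
  rw [h2] at h1
  linarith [le_abs_self a]

/-- Slater's condition yields Lagrange multipliers at an optimal solution. -/
theorem exists_multipliers (hP : P.Standing) (hB : P.BoundedSubdiff D0 D B) {xs : Vec N}
    (hxs : P.IsOptimal xs) :
    ∃ μ : Fin M → ℝ, (∀ m, 0 ≤ μ m) ∧
      ∀ x ∈ P.X, P.obj xs ≤ P.obj x + ∑ m, μ m * P.wc m x := by
  classical
  have hxsX : xs ∈ P.X := hxs.1.1
  -- Membership of the origin would produce a feasible point with objective strictly below the
  -- optimum.
  have h0 : (0 : ℝ × (Fin M → ℝ)) ∉ P.upperValues (P.obj xs) := by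
    rintro ⟨x, hx, h1, h2⟩
    have h3 := hxs.2 x ((isFeasible_iff hP hB).2 ⟨hx, fun m => (h2 m).le⟩)
    rw [← coe_obj hP hx, ← coe_obj hP hxsX] at h3
    have h4 : P.obj xs ≤ P.obj x := by exact_mod_cast h3
    simp only [Prod.fst_zero] at h1
    linarith
  obtain ⟨f, hf⟩ := geometric_hahn_banach_open_point (convex_upperValues hP hB (P.obj xs))
    (isOpen_upperValues (P.obj xs)) h0
  rw [map_zero] at hf
  -- The separating functional is negative on the open convex set, so its coordinates are taken with
  -- the opposite sign.
  set c : ℝ := -f (1, 0) with hc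
  set w : Fin M → ℝ := fun m => -f (0, Pi.single m 1) with hw
  have hfe : ∀ (a : ℝ) (q : Fin M → ℝ), -f (a, q) = c * a + ∑ m, w m * q m := by
    intro a q
    have e : (a, q) = a • ((1 : ℝ), (0 : Fin M → ℝ)) +
        ∑ m, q m • ((0 : ℝ), (Pi.single m 1 : Fin M → ℝ)) := by
      refine Prod.ext ?_ ?_
      · simp [Prod.fst_sum]
      · ext i
        simp [Prod.snd_sum, Pi.single_apply]
    rw [e, map_add, map_sum, map_smul]
    simp only [map_smul, smul_eq_mul, hc, hw, neg_mul, Finset.sum_neg_distrib, neg_add]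
    congr 1
    · ring
    · congr 1
      exact Finset.sum_congr rfl fun m _ => mul_comm _ _
  have key : ∀ x ∈ P.X, ∀ (a : ℝ) (q : Fin M → ℝ), 0 < a → (∀ m, 0 < q m) →
      0 < c * (P.obj x - P.obj xs + a) + ∑ m, w m * (P.wc m x + q m) := by
    intro x hx a q ha hq
    have h1 := hf (P.obj x - P.obj xs + a, fun m => P.wc m x + q m)
      ⟨x, hx, by simpa using ha, fun m => by simpa using hq m⟩
    have h2 := hfe (P.obj x - P.obj xs + a) fun m => P.wc m x + q m
    linarith
  -- The set is closed under increasing any coordinate, which forces nonnegative weights, here and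
  -- in `hw0`.
  have hc0 : 0 ≤ c := by
    refine nonneg_of_forall_add_mul_pos (a := c * (P.obj xs - P.obj xs + 1) +
      ∑ m, w m * (P.wc m xs + 1)) fun t ht => ?_
    have := key xs hxsX (1 + t) (fun _ => 1) (by linarith) fun _ => one_pos
    linarith
  have hw0 : ∀ m, 0 ≤ w m := by
    intro m
    refine nonneg_of_forall_add_mul_pos (a := c * (P.obj xs - P.obj xs + 1) +
      ∑ m, w m * (P.wc m xs + 1)) fun t ht => ?_
    have h1 := key xs hxsX 1 (fun i => 1 + t * Pi.single (M := fun _ => ℝ) m 1 i) one_pos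
      fun i => by
        rcases eq_or_ne i m with rfl | h
        · simp; linarith
        · simp [h]
    have h2 : ∑ i, w i * (P.wc i xs + (1 + t * Pi.single (M := fun _ => ℝ) m 1 i)) =
        ∑ i, w i * (P.wc i xs + 1) + t * w m := by
      have : ∀ i, w i * (P.wc i xs + (1 + t * Pi.single (M := fun _ => ℝ) m 1 i)) =
          w i * (P.wc i xs + 1) + t * (w i * Pi.single (M := fun _ => ℝ) m 1 i) := fun i => by ring
      simp only [this, Finset.sum_add_distrib, ← Finset.mul_sum]
      simp [Pi.single_apply]
    linarith
  have key' : ∀ x ∈ P.X, 0 ≤ c * (P.obj x - P.obj xs) + ∑ m, w m * P.wc m x := by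
    intro x hx
    have hs : 0 ≤ c + ∑ m, w m := add_nonneg hc0 (Finset.sum_nonneg fun m _ => hw0 m)
    by_contra! hneg
    set r := c * (P.obj x - P.obj xs) + ∑ m, w m * P.wc m x with hr
    -- Letting the slack tend to zero, done with one explicit slack `t`: as `t * (c + ∑ m, w m + 1)
    -- = -r`, the separated quantity equals `-t < 0`.
    have ht : 0 < -r / (c + ∑ m, w m + 1) := div_pos (by linarith) (by linarith)
    have h1 := key x hx _ (fun _ => -r / (c + ∑ m, w m + 1)) ht fun _ => ht
    simp only [mul_add, Finset.sum_add_distrib, ← Finset.sum_mul] at h1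
    have h2 : -r / (c + ∑ m, w m + 1) * (c + ∑ m, w m + 1) = -r := by field_simp
    linarith
  -- If `c = 0`, the Slater point forces every `w m` to vanish, and then strict separation reads `0
  -- < 0`.
  have hcpos : 0 < c := by
    refine hc0.lt_of_ne fun hc' => ?_
    obtain ⟨xb, hxb, hsl⟩ := hP.slater
    have hneg : ∀ m, P.wc m xb < 0 := fun m => by
      have := hsl m
      rw [← coe_wc hP hB m hxb] at this
      exact_mod_cast this
    have h1 := key' xb hxb
    rw [← hc', zero_mul, zero_add] at h1
    have h2 : ∀ m, w m = 0 := by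
      have h3 : ∀ m ∈ Finset.univ, w m * P.wc m xb ≤ 0 := fun m _ =>
        mul_nonpos_of_nonneg_of_nonpos (hw0 m) (hneg m).le
      have h4 := (Finset.sum_eq_zero_iff_of_nonpos h3).1
        (le_antisymm (Finset.sum_nonpos h3) h1)
      exact fun m => (mul_eq_zero.1 (h4 m (Finset.mem_univ m))).resolve_right (hneg m).ne
    have h5 := key xb hxb 1 (fun _ => 1) one_pos fun _ => one_pos
    simp [← hc', h2] at h5
  refine ⟨fun m => w m / c, fun m => div_nonneg (hw0 m) hc0, fun x hx => ?_⟩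
  have h1 := key' x hx
  have h2 : ∑ m, w m / c * P.wc m x = (∑ m, w m * P.wc m x) / c := by
    rw [Finset.sum_div]; exact Finset.sum_congr rfl fun m _ => by ring
  have h3 : 0 ≤ (c * (P.obj x - P.obj xs) + ∑ m, w m * P.wc m x) / c := div_nonneg h1 hc0
  rw [add_div, mul_div_cancel_left₀ _ hcpos.ne'] at h3
  rw [h2]
  linarith

end RobustProblem

/-! ### The outer algorithm: potential, bounded multipliers and averaging. -/

namespace RobustProblem

variable {N M : ℕ} {J : Fin M → ℕ} {P : RobustProblem N M J} {D0 : ℝ} {D B : Fin M → ℝ}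

/-- The Lagrangian of the robust problem. -/
noncomputable def lagrangian (P : RobustProblem N M J) (x : Vec N) (μ : Fin M → ℝ) : ℝ :=
  P.obj x + ∑ m, μ m * P.wc m x

/-- The contribution of the iterate `p` to the primal-dual gap of the Lagrangian. -/
noncomputable def outerGap (P : RobustProblem N M J) (u : Vec N) (μ : Fin M → ℝ)
    (p : Vec N × (Fin M → ℝ)) : ℝ :=
  P.lagrangian p.1 μ - P.lagrangian u p.2

/-- Choosing `v` as the worst case at `x` and bounding `z` by the worst case at `u` eliminates the
uncertain variables: the inner output is an inexact proximal step on the Lagrangian. -/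
theorem lagrangian_le_of_saddle (hP : P.Standing) (hB : P.BoundedSubdiff D0 D B) {α ν : ℝ}
    {lam : Fin M → ℝ} (hlam : ∀ m, 0 ≤ lam m) {xk x u : Vec N} {z : (m : Fin M) → Vec (J m)}
    (h : P.IsStrongApproxSaddle α ν lam xk x z) (hu : u ∈ P.X) :
    P.lagrangian x lam + 1 / (2 * α) * ‖x - xk‖ ^ 2 ≤ P.lagrangian u lam +
      1 / (2 * α) * ‖u - xk‖ ^ 2 - 1 / (2 * α) * ‖u - x‖ ^ 2 + ν := by
  obtain ⟨hx, hz, h⟩ := h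
  choose v hv _ hwc using fun m => exists_worst_eq hP hB m hx
  have h1 := h u hu v hv
  have h2 : ∑ m, lam m * P.con m u (z m) ≤ ∑ m, lam m * P.wc m u :=
    Finset.sum_le_sum fun m _ =>
      mul_le_mul_of_nonneg_left (con_le_wc hP hB hu (hz m)) (hlam m)
  have e : 1 / α / 2 = 1 / (2 * α) := by rw [div_div, mul_comm]
  rw [e] at h1
  simp only [innerObj] at h1
  simp only [con] at h2 hwc
  simp only [lagrangian, obj, hwc]
  linarith

/-- The three-point inequality for the projection onto the half-line, in one dimension. -/
theorem multiplier_step {β lam s μ : ℝ} (hβ : 0 < β) (hμ : 0 ≤ μ) :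
    s * (μ - max (lam + β * s) 0) ≤ 1 / (2 * β) * ((μ - lam) ^ 2 -
      (μ - max (lam + β * s) 0) ^ 2 - (max (lam + β * s) 0 - lam) ^ 2) := by
  have h : (lam + β * s - max (lam + β * s) 0) * (μ - max (lam + β * s) 0) ≤ 0 := by
    rcases le_total 0 (lam + β * s) with h | h
    · rw [max_eq_left h]; simp
    · rw [max_eq_right h]; simpa using mul_nonpos_of_nonpos_of_nonneg h hμ
  generalize max (lam + β * s) 0 = l at h ⊢
  rw [div_mul_eq_mul_div, le_div_iff₀ (by positivity)]
  linarith

/-- The coefficient of `Δ ^ 2` is exactly the square released by `multiplier_step`. -/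
theorem mul_le_young {β Δ d c θ : ℝ} (hβ : 0 < β) (hd : |d| ≤ c + θ) :
    Δ * d ≤ 1 / (2 * β) * Δ ^ 2 + β * c ^ 2 + β * θ ^ 2 := by
  have h1 : Δ * d ≤ |Δ| * (c + θ) := by
    refine (le_abs_self _).trans ?_
    rw [abs_mul]
    exact mul_le_mul_of_nonneg_left hd (abs_nonneg _)
  have h2 : 1 / (2 * β) * Δ ^ 2 + β * c ^ 2 + β * θ ^ 2 - |Δ| * (c + θ) =
      ((|Δ| - 2 * β * c) ^ 2 + (|Δ| - 2 * β * θ) ^ 2) / (4 * β) := by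
    rw [← sq_abs Δ]; field_simp; ring
  have h3 : 0 ≤ ((|Δ| - 2 * β * c) ^ 2 + (|Δ| - 2 * β * θ) ^ 2) / (4 * β) := by positivity
  linarith

/-- Only `3 / (8 * β)` of the available `1 / (2 * β)` is spent, so `1 / (8 * β)` remains to control
the multipliers. The coefficient of `c ^ 2` stays `β` to fit `sum_mul_sq_le`. -/
theorem mul_le_young' {β Δ d c θ : ℝ} (hβ : 0 < β) (hd : |d| ≤ c + θ) :
    Δ * d ≤ 3 / (8 * β) * Δ ^ 2 + β * c ^ 2 + 2 * β * θ ^ 2 := by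
  have h1 : Δ * d ≤ |Δ| * (c + θ) := by
    refine (le_abs_self _).trans ?_
    rw [abs_mul]
    exact mul_le_mul_of_nonneg_left hd (abs_nonneg _)
  have h2 : 3 / (8 * β) * Δ ^ 2 + β * c ^ 2 + 2 * β * θ ^ 2 - |Δ| * (c + θ) =
      (2 * (|Δ| - 2 * β * c) ^ 2 + (|Δ| - 4 * β * θ) ^ 2) / (8 * β) := by
    rw [← sq_abs Δ]; field_simp; ring
  have h3 : 0 ≤ (2 * (|Δ| - 2 * β * c) ^ 2 + (|Δ| - 4 * β * θ) ^ 2) / (8 * β) := by positivity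
  linarith

/-- Multiplying the two step-size conditions gives `2 * α * β * ∑ m, D m ^ 2 ≤ 1`. -/
theorem sum_mul_sq_le {α β : ℝ} (hα : 0 < α) (hβ : 0 < β) (hαD : α * √(∑ m, D m ^ 2) ≤ 1)
    (hβD : 2 * β * √(∑ m, D m ^ 2) ≤ 1) (b : ℝ) :
    ∑ m, β * (D m * b) ^ 2 ≤ 1 / (2 * α) * b ^ 2 := by
  have h0 : 0 ≤ ∑ m, D m ^ 2 := Finset.sum_nonneg fun m _ => sq_nonneg _
  have h1 := mul_le_mul hαD hβD (by positivity) zero_le_one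
  have h2 := Real.mul_self_sqrt h0
  have h3 : β * ∑ m, D m ^ 2 ≤ 1 / (2 * α) := by
    rw [le_div_iff₀ (by positivity)]
    calc (β * ∑ m, D m ^ 2) * (2 * α)
        = α * √(∑ m, D m ^ 2) * (2 * β * √(∑ m, D m ^ 2)) := by
          nth_rewrite 1 [← h2]; ring
      _ ≤ 1 := by linarith
  calc ∑ m, β * (D m * b) ^ 2 = (β * ∑ m, D m ^ 2) * b ^ 2 := by
        rw [Finset.mul_sum, Finset.sum_mul]; exact Finset.sum_congr rfl fun m _ => by ring
    _ ≤ _ := mul_le_mul_of_nonneg_right h3 (sq_nonneg b)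

/-- The potential of the outer algorithm. -/
noncomputable def outerPotential (α β : ℝ) (u : Vec N) (μ : Fin M → ℝ) (x : Vec N)
    (lam : Fin M → ℝ) (b : ℝ) (d : Fin M → ℝ) : ℝ :=
  1 / (2 * α) * ‖u - x‖ ^ 2 + ∑ m, (1 / (2 * β) * (μ m - lam m) ^ 2 - (μ m - lam m) * d m) +
    1 / (2 * α) * b ^ 2

/-- The error made in one iteration of the outer algorithm. -/
noncomputable def outerError (β θ : ℝ) (μ : Fin M → ℝ) : ℝ :=
  θ + ∑ m, (θ * μ m + β * θ ^ 2)

/-- Here `b` stands for the length of the previous primal step. Young's inequality charges `β * (D m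
* b) ^ 2` for the change of the constraint values, paid by the term in `b` stored in the potential;
the saddle inequality refills it with `‖x' - x‖`. -/
theorem outer_step (hP : P.Standing) (hB : P.BoundedSubdiff D0 D B) {α β θ : ℝ}
    (hα : 0 < α) (hβ : 0 < β) (hαD : α * √(∑ m, D m ^ 2) ≤ 1)
    (hβD : 2 * β * √(∑ m, D m ^ 2) ≤ 1)
    {x x' u : Vec N} {lam lam' gz gp gz' μ : Fin M → ℝ} {z : (m : Fin M) → Vec (J m)} {b : ℝ}
    (hd : ∀ m, |gz m - gp m| ≤ D m * b + θ)
    (hlam' : ∀ m, lam' m = max (lam m + β * (2 * gz m - gp m)) 0)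
    (hx' : P.IsStrongApproxSaddle α θ lam' x x' z) (hu : u ∈ P.X) (hμ : ∀ m, 0 ≤ μ m)
    (hgz' : ∀ m, gz' m ≤ P.wc m x' ∧ P.wc m x' ≤ gz' m + θ) :
    P.outerGap u μ (x', lam') +
        outerPotential α β u μ x' lam' ‖x' - x‖ (fun m => gz' m - gz m) ≤
      outerPotential α β u μ x lam b (fun m => gz m - gp m) + outerError β θ μ := by
  have hlam0 : ∀ m, 0 ≤ lam' m := fun m => by rw [hlam']; exact le_max_right _ _
  have h1 := lagrangian_le_of_saddle hP hB hlam0 hx' hu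
  have h2 : ∀ m, (μ m - lam' m) * P.wc m x' +
      (1 / (2 * β) * (μ m - lam' m) ^ 2 - (μ m - lam' m) * (gz' m - gz m)) ≤
      (1 / (2 * β) * (μ m - lam m) ^ 2 - (μ m - lam m) * (gz m - gp m)) +
        β * (D m * b) ^ 2 + (θ * μ m + β * θ ^ 2) := by
    intro m
    have a1 := multiplier_step (lam := lam m) (s := 2 * gz m - gp m) hβ (hμ m)
    rw [← hlam'] at a1
    have a2 := mul_le_young (Δ := lam' m - lam m) hβ (hd m)
    have a3 := mul_le_mul_of_nonneg_left
      (show P.wc m x' - gz' m ≤ θ by linarith [(hgz' m).2]) (hμ m)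
    have a4 := mul_nonneg (hlam0 m) (sub_nonneg.2 (hgz' m).1)
    linarith
  have h3 := Finset.sum_le_sum fun m (_ : m ∈ Finset.univ) => h2 m
  have h4 := sum_mul_sq_le hα hβ hαD hβD b
  have e : ∑ m, (μ m - lam' m) * P.wc m x' =
      ∑ m, μ m * P.wc m x' - ∑ m, lam' m * P.wc m x' := by
    rw [← Finset.sum_sub_distrib]; exact Finset.sum_congr rfl fun m _ => by ring
  rw [Finset.sum_add_distrib, Finset.sum_add_distrib, Finset.sum_add_distrib, e] at h3
  simp only [outerGap, outerPotential, outerError, lagrangian] at h1 h3 ⊢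
  linarith

/-- The budget of the outer algorithm, a bound on its initial potential and total error. -/
noncomputable def outerBudget (α β dX : ℝ) (μ : Fin M → ℝ) : ℝ :=
  1 / (2 * α) * dX ^ 2 + ∑ m, (1 / (2 * β) * μ m ^ 2 + μ m + 3 * β) + 1

/-- The invariant of the outer loop after `n` iterations. -/
def OuterInvariant (P : RobustProblem N M J) (D : Fin M → ℝ) (α β θ dX : ℝ) (n : ℕ) (x : Vec N)
    (lam : Fin M → ℝ) (gp : Option (Fin M → ℝ)) (sx : Vec N)
    (l : List (Vec N × (Fin M → ℝ))) : Prop :=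
  l.length = n ∧ sx = (l.map Prod.fst).sum ∧ (∀ p ∈ l, p.1 ∈ P.X ∧ ∀ m, 0 ≤ p.2 m) ∧
    ∃ b : ℝ, ∀ gz : Fin M → ℝ, (∀ m, gz m ≤ P.wc m x ∧ P.wc m x ≤ gz m + θ) →
      (∀ m, |gz m - gp.getD gz m| ≤ D m * b + θ) ∧
      ∀ u ∈ P.X, ∀ μ : Fin M → ℝ, (∀ m, 0 ≤ μ m) →
        (l.map (P.outerGap u μ)).sum +
            outerPotential α β u μ x lam b (fun m => gz m - gp.getD gz m) ≤
          1 / (2 * α) * dX ^ 2 + ∑ m, 1 / (2 * β) * μ m ^ 2 + n * outerError β θ μ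

/-- Instantiating the invariant at the exact worst-case values bounds the potential below, up to `2
* β` per constraint. Since `n * θ ≤ 1`, the accumulated errors stay bounded in `n`. -/
theorem OuterInvariant.sum_le {α β θ dX : ℝ} (hα : 0 < α) (hβ : 0 < β)
    (hαD : α * √(∑ m, D m ^ 2) ≤ 1) (hβD : 2 * β * √(∑ m, D m ^ 2) ≤ 1) {n : ℕ} (hθ : 0 ≤ θ)
    (hθ1 : θ ≤ 1) (hn : n * θ ≤ 1) {x : Vec N} {lam : Fin M → ℝ} {gp : Option (Fin M → ℝ)}
    {sx : Vec N} {l : List (Vec N × (Fin M → ℝ))}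
    (h : P.OuterInvariant D α β θ dX n x lam gp sx l) {u : Vec N} (hu : u ∈ P.X) {μ : Fin M → ℝ}
    (hμ : ∀ m, 0 ≤ μ m) :
    (l.map (P.outerGap u μ)).sum + ∑ m, 1 / (8 * β) * (μ m - lam m) ^ 2 ≤
      outerBudget α β dX μ := by
  obtain ⟨-, -, -, b, h⟩ := h
  obtain ⟨hd, h⟩ := h (fun m => P.wc m x) fun m => ⟨le_rfl, by linarith⟩
  have h1 := h u hu μ hμ
  have h2 : ∑ m, 1 / (8 * β) * (μ m - lam m) ^ 2 ≤
      outerPotential α β u μ x lam b (fun m => P.wc m x - gp.getD (fun m => P.wc m x) m) +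
        ∑ _m : Fin M, 2 * β := by
    have h3 := sum_mul_sq_le hα hβ hαD hβD b
    have h4 : ∀ m, 1 / (8 * β) * (μ m - lam m) ^ 2 ≤ (1 / (2 * β) * (μ m - lam m) ^ 2 -
        (μ m - lam m) * (P.wc m x - gp.getD (fun m => P.wc m x) m)) +
        β * (D m * b) ^ 2 + 2 * β := by
      intro m
      have h5 := mul_le_young' (Δ := μ m - lam m) hβ (hd m)
      have h6 : 1 / (2 * β) * (μ m - lam m) ^ 2 =
          1 / (8 * β) * (μ m - lam m) ^ 2 + 3 / (8 * β) * (μ m - lam m) ^ 2 := by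
        field_simp; ring
      have h7 : 2 * β * θ ^ 2 ≤ 2 * β := by
        have : θ ^ 2 ≤ 1 := pow_le_one₀ hθ hθ1
        have := mul_le_mul_of_nonneg_left this (show 0 ≤ 2 * β by linarith)
        linarith
      linarith
    have h5 := Finset.sum_le_sum fun m (_ : m ∈ Finset.univ) => h4 m
    rw [Finset.sum_add_distrib, Finset.sum_add_distrib] at h5
    have h6 : 0 ≤ 1 / (2 * α) * ‖u - x‖ ^ 2 := by positivity
    rw [outerPotential]
    linarith
  have h3 : n * outerError β θ μ ≤ 1 + ∑ m, (μ m + β) := by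
    rw [outerError, mul_add, Finset.mul_sum]
    refine add_le_add hn (Finset.sum_le_sum fun m _ => ?_)
    have h4 := mul_le_mul_of_nonneg_right hn (hμ m)
    have h5 : n * θ * (β * θ) ≤ 1 * (β * 1) :=
      mul_le_mul hn (mul_le_mul_of_nonneg_left hθ1 hβ.le) (by positivity) zero_le_one
    linarith
  have e : outerBudget α β dX μ = 1 / (2 * α) * dX ^ 2 + ∑ m, 1 / (2 * β) * μ m ^ 2 +
      (1 + ∑ m, (μ m + β)) + ∑ _m : Fin M, 2 * β := by
    have : ∀ m, 1 / (2 * β) * μ m ^ 2 + μ m + 3 * β =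
        1 / (2 * β) * μ m ^ 2 + (μ m + β) + 2 * β := fun m => by ring
    simp only [outerBudget, this]
    rw [Finset.sum_add_distrib, Finset.sum_add_distrib]
    ring
  rw [e]
  linarith

/-- A bound on the multipliers met by the outer algorithm, given Lagrange multipliers `μ`. -/
noncomputable def multiplierBound (α β dX A : ℝ) (μ : Fin M → ℝ) : ℝ :=
  ∑ m, μ m + √(8 * β * outerBudget α β dX μ) + β * (3 * A)

/-- Against an optimal primal-dual pair every gap is nonnegative, so the leftover square alone is
within the budget. The summand `β * (3 * A)` covers one further dual step, as the inner algorithm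
runs with the updated multiplier. -/
theorem OuterInvariant.multiplier_le {α β θ dX A : ℝ} (hP : P.Standing)
    (hB : P.BoundedSubdiff D0 D B) (hα : 0 < α) (hβ : 0 < β)
    (hαD : α * √(∑ m, D m ^ 2) ≤ 1) (hβD : 2 * β * √(∑ m, D m ^ 2) ≤ 1) {n : ℕ} (hθ : 0 ≤ θ)
    (hθ1 : θ ≤ 1) (hn : n * θ ≤ 1) {x : Vec N} {lam : Fin M → ℝ} {gp : Option (Fin M → ℝ)}
    {sx : Vec N} {l : List (Vec N × (Fin M → ℝ))}
    (h : P.OuterInvariant D α β θ dX n x lam gp sx l) {xs : Vec N} (hxs : P.IsFeasible xs)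
    {μ : Fin M → ℝ} (hμ : ∀ m, 0 ≤ μ m)
    (hμs : ∀ x ∈ P.X, P.obj xs ≤ P.obj x + ∑ m, μ m * P.wc m x) (m : Fin M) :
    lam m + β * (3 * A) ≤ multiplierBound α β dX A μ := by
  obtain ⟨hxsX, hxs⟩ := (isFeasible_iff hP hB).1 hxs
  have h1 := h.sum_le hα hβ hαD hβD hθ hθ1 hn hxsX hμ
  have h2 : 0 ≤ (l.map (P.outerGap xs μ)).sum := by
    refine List.sum_nonneg fun a ha => ?_
    obtain ⟨p, hp, rfl⟩ := List.mem_map.1 ha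
    obtain ⟨hpX, hp0⟩ := h.2.2.1 p hp
    have h3 := hμs p.1 hpX
    have h4 : ∑ m, p.2 m * P.wc m xs ≤ 0 := Finset.sum_nonpos fun m _ =>
      mul_nonpos_of_nonneg_of_nonpos (hp0 m) (hxs m)
    simp only [outerGap, lagrangian]
    linarith
  have h3 := Finset.single_le_sum (f := fun m => 1 / (8 * β) * (μ m - lam m) ^ 2)
    (fun m _ => by positivity) (Finset.mem_univ m)
  have h4 : (lam m - μ m) ^ 2 ≤ 8 * β * outerBudget α β dX μ := by
    have h5 : 1 / (8 * β) * (μ m - lam m) ^ 2 ≤ outerBudget α β dX μ := by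
      linarith
    rw [div_mul_eq_mul_div, div_le_iff₀ (by positivity)] at h5
    linarith
  have h5 := Real.le_sqrt_of_sq_le h4
  have h6 := Finset.single_le_sum (f := μ) (fun m _ => hμ m) (Finset.mem_univ m)
  rw [multiplierBound]
  linarith

theorem outerLoop_ensures (hP : P.Standing) (hB : P.BoundedSubdiff D0 D B) {α β θ dX A Λ : ℝ}
    (hα : 0 < α) (hβ : 0 < β) (hαD : α * √(∑ m, D m ^ 2) ≤ 1)
    (hβD : 2 * β * √(∑ m, D m ^ 2) ≤ 1) (hA : ∀ m, ∀ x ∈ P.X, ∀ z ∈ P.Z m, |P.con m x z| ≤ A)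
    {K : ℕ}
    (hΛ : ∀ (n : ℕ) (x : Vec N) (lam : Fin M → ℝ) (gp : Option (Fin M → ℝ)) (sx : Vec N)
      (l : List (Vec N × (Fin M → ℝ))), n ≤ K → P.OuterInvariant D α β θ dX n x lam gp sx l →
      ∀ m, lam m + β * (3 * A) ≤ Λ) (hΛ0 : 0 ≤ Λ)
    {find : Vec N → Prog N M J ((m : Fin M) → Vec (J m))} {cf : ℕ}
    (hfind : ∀ x ∈ P.X, (find x).Ensures P fun z c =>
      (∀ m, P.IsApproxMaximiser θ x m (z m)) ∧ c ≤ cf)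
    {inner : (Fin M → ℝ) → Vec N → Prog N M J (Vec N × ((m : Fin M) → Vec (J m)))} {ci : ℕ}
    (hinner : ∀ (lam : Fin M → ℝ) (x : Vec N), (∀ m, 0 ≤ lam m) → (∀ m, lam m ≤ Λ) → x ∈ P.X →
      (inner lam x).Ensures P fun r c => P.IsStrongApproxSaddle α θ lam x r.1 r.2 ∧ c ≤ ci)
    (j : ℕ) :
    ∀ (n : ℕ) (x : Vec N) (lam : Fin M → ℝ) (gp : Option (Fin M → ℝ)) (sx : Vec N)
      (l : List (Vec N × (Fin M → ℝ))), n + j = K → x ∈ P.X → (∀ g ∈ gp, ∀ m, |g m| ≤ A) →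
      P.OuterInvariant D α β θ dX n x lam gp sx l →
      (outerLoop P α β θ θ find inner j x lam gp sx).Ensures P fun s c =>
        (∃ y lam gp l, P.OuterInvariant D α β θ dX K y lam gp s l) ∧ c ≤ j * (cf + ci) := by
  induction j with
  | zero =>
    intro n x lam gp sx l hn hx hgp hinv
    obtain rfl : n = K := by simpa using hn
    exact ⟨⟨x, lam, gp, l, hinv⟩, by simp⟩
  | succ j ih =>
    intro n x lam gp sx l hn hx hgp hinv
    have hlam := hΛ n x lam gp sx l (by omega) hinv
    refine Prog.Ensures.bind ((hfind x hx).mono ?_)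
    rintro z c1 ⟨hz, hc1⟩
    refine ⟨hz, ?_⟩
    set gz : Fin M → ℝ := fun m => (P.g m x (z m)).toReal with hgz
    have hgzA : ∀ m, |gz m| ≤ A := fun m => hA m x hx (z m) (hz m).1
    have hgpA : ∀ m, |gp.getD gz m| ≤ A := by
      cases gp with
      | none => exact hgzA
      | some g => exact hgp g rfl
    have hgzv : ∀ m, gz m ≤ P.wc m x ∧ P.wc m x ≤ gz m + θ := fun m =>
      ⟨con_le_wc hP hB hx (hz m).1, (isApproxMaximiser_iff hP hB hx (hz m).1 θ).1 (hz m)⟩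
    set lam' : Fin M → ℝ := fun m => max (lam m + β * (2 * gz m - gp.getD gz m)) 0 with hlam'
    have hlam0 : ∀ m, 0 ≤ lam' m := fun m => le_max_right _ _
    have hlamΛ : ∀ m, lam' m ≤ Λ := by
      refine fun m => max_le (le_trans ?_ (hlam m)) hΛ0
      have h1 := abs_le.1 (hgzA m)
      have h2 := abs_le.1 (hgpA m)
      have h3 := mul_le_mul_of_nonneg_left
        (show 2 * gz m - gp.getD gz m ≤ 3 * A by linarith) hβ.le
      linarith
    refine Prog.Ensures.bind ((hinner lam' x hlam0 hlamΛ hx).mono ?_)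
    rintro r c2 ⟨hr, hc2⟩
    refine ⟨hr, ?_⟩
    refine (ih (n + 1) r.1 lam' (some gz) (sx + r.1) ((r.1, lam') :: l) (by omega) hr.1
      (fun g hg => by cases hg; exact hgzA) ?_).mono ?_
    · obtain ⟨h1, h2, h3, b, h4⟩ := hinv
      obtain ⟨hd, h5⟩ := h4 gz hgzv
      -- The new value of `b` is the length of the primal step just made; by Lipschitz continuity it
      -- bounds the next change of the constraint values up to `θ`.
      refine ⟨by simp [h1], by simp [h2, add_comm], ?_, ‖r.1 - x‖, fun gz' hgz' => ⟨?_, ?_⟩⟩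
      · intro p hp
        rcases List.mem_cons.1 hp with rfl | hp
        · exact ⟨hr.1, hlam0⟩
        · exact h3 p hp
      · intro m
        have a1 := wc_sub_le hP hB (m := m) hr.1 hx
        have a2 := wc_sub_le hP hB (m := m) hx hr.1
        rw [norm_sub_rev] at a2
        have a3 := hgzv m
        have a4 := hgz' m
        rw [Option.getD_some, abs_le]
        constructor <;> linarith
      · intro u hu μ hμ
        have h6 := h5 u hu μ hμ
        have h7 := outer_step hP hB hα hβ hαD hβD hd (fun m => rfl) hr hu hμ hgz'
        simp only [List.map_cons, List.sum_cons, Option.getD_some, Nat.cast_add, Nat.cast_one]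
        linarith
    · rintro s c3 ⟨hs, hc3⟩
      refine ⟨hs, ?_⟩
      calc c1 + (c2 + c3) ≤ cf + (ci + j * (cf + ci)) := by omega
        _ = (j + 1) * (cf + ci) := by ring

theorem outerInvariant_zero {α β θ dX : ℝ} (hα : 0 < α) (hθ : 0 ≤ θ)
    (hdX : ∀ x ∈ P.X, ∀ y ∈ P.X, ‖x - y‖ ≤ dX) {x0 : Vec N} (hx0 : x0 ∈ P.X) :
    P.OuterInvariant D α β θ dX 0 x0 (fun _ => 0) none 0 [] := by
  refine ⟨rfl, by simp, by simp, 0, fun gz _ => ⟨fun m => by simpa using hθ, fun u hu μ _ => ?_⟩⟩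
  have h := mul_le_mul_of_nonneg_left (pow_le_pow_left₀ (norm_nonneg _) (hdX u hu x0 hx0) 2)
    (show 0 ≤ 1 / (2 * α) by positivity)
  simpa [outerPotential] using h

/-- Jensen in the primal variable suffices: at a feasible `xs` and nonnegative multipliers the
Lagrangian is at most `P.obj xs`, so the dual iterates drop out. -/
theorem OuterInvariant.lagrangian_average_le {α β θ dX : ℝ} (hP : P.Standing)
    (hB : P.BoundedSubdiff D0 D B) (hα : 0 < α) (hβ : 0 < β)
    (hαD : α * √(∑ m, D m ^ 2) ≤ 1) (hβD : 2 * β * √(∑ m, D m ^ 2) ≤ 1) {K : ℕ} (hK : 0 < K)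
    (hθ : 0 ≤ θ) (hθ1 : θ ≤ 1) (hn : K * θ ≤ 1) {x : Vec N} {lam : Fin M → ℝ}
    {gp : Option (Fin M → ℝ)} {sx : Vec N} {l : List (Vec N × (Fin M → ℝ))}
    (h : P.OuterInvariant D α β θ dX K x lam gp sx l) {xs : Vec N} (hxs : P.IsFeasible xs) :
    (1 / (K : ℝ)) • sx ∈ P.X ∧ ∀ μ : Fin M → ℝ, (∀ m, 0 ≤ μ m) →
      P.lagrangian ((1 / (K : ℝ)) • sx) μ - P.obj xs ≤ outerBudget α β dX μ / K := by
  obtain ⟨hxsX, hxs⟩ := (isFeasible_iff hP hB).1 hxs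
  have h' := h
  obtain ⟨h1, h2, h3, -⟩ := h'
  have hKr : (0 : ℝ) < K := by exact_mod_cast hK
  have hl : l ≠ [] := by rintro rfl; simp at h1; omega
  have hxX : (1 / (K : ℝ)) • sx ∈ P.X := by
    rw [h2, ← h1]; exact average_mem hP.X_convex l _ (fun p hp => (h3 p hp).1) hl
  refine ⟨hxX, fun μ hμ => ?_⟩
  have h4 := h.sum_le hα hβ hαD hβD hθ hθ1 hn hxsX hμ
  have h5 : 0 ≤ ∑ m, 1 / (8 * β) * (μ m - lam m) ^ 2 :=
    Finset.sum_nonneg fun m _ => by positivity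
  obtain ⟨ξ0, hξ0⟩ := hB.f0_nonempty _ hxX
  choose ξ hξ using fun m => exists_wc_subgrad hP hB m hxX
  have h6 := length_mul_le_sum_of_subgradient l Prod.fst (fun y => P.lagrangian y μ - P.obj xs)
    (p := (1 / (K : ℝ)) • sx) (ξ := ξ0 + ∑ m, μ m • ξ m) (fun p hp => by
      have a1 := obj_subgrad hP hxX (h3 p hp).1 hξ0
      have a2 := Finset.sum_le_sum fun m (_ : m ∈ Finset.univ) =>
        mul_le_mul_of_nonneg_left (hξ m p.1 (h3 p hp).1) (hμ m)
      simp only [mul_add, Finset.sum_add_distrib] at a2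
      rw [inner_add_left, sum_inner]
      simp only [real_inner_smul_left, lagrangian]
      linarith) (by rw [h1, smul_smul, mul_one_div_cancel hKr.ne', one_smul, h2])
  have h7 : (l.map fun p => P.lagrangian p.1 μ - P.obj xs).sum ≤
      (l.map (P.outerGap xs μ)).sum := by
    refine List.sum_le_sum fun p hp => ?_
    have : ∑ m, p.2 m * P.wc m xs ≤ 0 := Finset.sum_nonpos fun m _ =>
      mul_nonpos_of_nonneg_of_nonpos ((h3 p hp).2 m) (hxs m)
    simp only [outerGap, lagrangian]
    linarith
  rw [le_div_iff₀ hKr]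
  rw [h1] at h6
  linarith

theorem proM3_ensures (hP : P.Standing) (hB : P.BoundedSubdiff D0 D B) {α β dX A : ℝ}
    (hα : 0 < α) (hβ : 0 < β) (hαD : α * √(∑ m, D m ^ 2) ≤ 1)
    (hβD : 2 * β * √(∑ m, D m ^ 2) ≤ 1) (hdX : ∀ x ∈ P.X, ∀ y ∈ P.X, ‖x - y‖ ≤ dX)
    (hA0 : 0 ≤ A) (hA : ∀ m, ∀ x ∈ P.X, ∀ z ∈ P.Z m, |P.con m x z| ≤ A) {xs : Vec N}
    (hxs : P.IsOptimal xs) {μ : Fin M → ℝ} (hμ : ∀ m, 0 ≤ μ m)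
    (hμs : ∀ x ∈ P.X, P.obj xs ≤ P.obj x + ∑ m, μ m * P.wc m x) {K : ℕ} (hK : 0 < K)
    {find : Vec N → Prog N M J ((m : Fin M) → Vec (J m))} {cf : ℕ}
    (hfind : ∀ x ∈ P.X, (find x).Ensures P fun z c =>
      (∀ m, P.IsApproxMaximiser (1 / K) x m (z m)) ∧ c ≤ cf) {T : ℕ} {γ δ : ℝ} {ci : ℕ}
    (hinner : ∀ (lam : Fin M → ℝ) (x : Vec N), (∀ m, 0 ≤ lam m) →
      (∀ m, lam m ≤ multiplierBound α β dX A μ) → x ∈ P.X →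
      (innerAlg T α γ δ lam x).Ensures P fun r c =>
        P.IsStrongApproxSaddle α (1 / K) lam x r.1 r.2 ∧ c ≤ ci) {ε : ℝ}
    (hε0 : outerBudget α β dX (0 : Fin M → ℝ) / K ≤ ε)
    (hεm : ∀ m, outerBudget α β dX (μ + Pi.single m 1) / K ≤ ε) (hε : 0 ≤ ε) {x0 : Vec N}
    (hx0 : x0 ∈ P.X) :
    (proM3 P α β (1 / K) (1 / K) find K T γ δ x0).Ensures P fun x c =>
      P.IsApproxOptimal ε x ∧ c ≤ K * (cf + ci) := by
  have hKr : (1 : ℝ) ≤ K := by exact_mod_cast hK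
  have hθ : (0 : ℝ) ≤ 1 / K := by positivity
  have hθ1 : (1 : ℝ) / K ≤ 1 := by rw [div_le_one (by linarith)]; exact hKr
  have hKθ : (K : ℝ) * (1 / K) = 1 := mul_one_div_cancel (by linarith)
  have hn' : ∀ n : ℕ, n ≤ K → (n : ℝ) * (1 / K) ≤ 1 := fun n hn => by
    rw [mul_one_div]
    exact div_le_one_of_le₀ (Nat.cast_le.2 hn) (by linarith)
  have hΛ0 : 0 ≤ multiplierBound α β dX A μ := by
    have := Finset.sum_nonneg fun m (_ : m ∈ Finset.univ) => hμ m
    have := Real.sqrt_nonneg (8 * β * outerBudget α β dX μ)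
    rw [multiplierBound]
    positivity
  refine Prog.Ensures.bind ((outerLoop_ensures hP hB (dX := dX) hα hβ hαD hβD hA (K := K)
    (fun n x lam gp sx l hn h => h.multiplier_le hP hB hα hβ hαD hβD hθ hθ1 (hn' n hn) hxs.1 hμ hμs)
    hΛ0 hfind hinner K 0 x0 _ none 0 [] (zero_add K) hx0 (fun _ h => by cases h)
    (outerInvariant_zero hα hθ hdX hx0)).mono ?_)
  · rintro s c ⟨⟨y, lam, gp, l, h⟩, hc⟩
    obtain ⟨hxX, h1⟩ := h.lagrangian_average_le hP hB hα hβ hαD hβD hK hθ hθ1 hKθ.le hxs.1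
    refine ⟨⟨hxX, ⟨xs, hxs, ?_⟩, fun m => ?_⟩, by simpa using hc⟩
    · have h2 := (h1 0 fun _ => le_rfl).trans hε0
      simp only [lagrangian, Pi.zero_apply, zero_mul, Finset.sum_const_zero, add_zero] at h2
      rw [← coe_obj hP hxX, ← coe_obj hP hxs.1.1]
      have h3 : P.obj ((1 / (K : ℝ)) • s) ≤ P.obj xs + ε := by linarith
      exact_mod_cast h3
    -- By optimality of `μ`, the Lagrangian at `μ` is at least the optimal value; the additional
    -- unit in coordinate `m` isolates the violation of constraint `m`.
    · have h2 := (h1 (μ + Pi.single m 1) fun i => add_nonneg (hμ i)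
        (by rcases eq_or_ne i m with rfl | h <;> simp [*])).trans (hεm m)
      have h3 := hμs _ hxX
      have h4 : P.lagrangian ((1 / (K : ℝ)) • s) (μ + Pi.single m 1) =
          P.obj ((1 / (K : ℝ)) • s) + ∑ i, μ i * P.wc i ((1 / (K : ℝ)) • s) +
            P.wc m ((1 / (K : ℝ)) • s) := by
        simp [lagrangian, add_mul, Finset.sum_add_distrib, Pi.single_apply, add_assoc]
      rw [h4] at h2
      refine max_le ?_ (by exact_mod_cast hε)
      rw [← coe_wc hP hB m hxX]
      have h5 : P.wc m ((1 / (K : ℝ)) • s) ≤ ε := by linarith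
      exact_mod_cast h5

end RobustProblem

/-! ### Choice of parameters and the count of calls. -/

theorem one_div_sqrt_le {a c : ℝ} (ha : 0 < a) (hc : a ^ 2 ≤ c) {K T : ℕ} (hK : 0 < K)
    (hT : c * (K : ℝ) ^ 2 ≤ T) : a * (1 / √T) ≤ 1 / K := by
  have hKr : (0 : ℝ) < K := by exact_mod_cast hK
  have h1 : (a * K) ^ 2 ≤ T := by
    rw [mul_pow]; exact (mul_le_mul_of_nonneg_right hc (sq_nonneg _)).trans hT
  have h2 : a * K ≤ √T := Real.le_sqrt_of_sq_le h1
  have h3 : 0 < a * K := mul_pos ha hKr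
  rw [mul_one_div, div_le_div_iff₀ (h3.trans_le h2) hKr]
  linarith

theorem ceil_le_add_one_mul_max {c ε : ℝ} (hc : 0 < c) (hε : 0 < ε) :
    (⌈c / ε⌉₊ : ℝ) ≤ (c + 1) * max 1 (1 / ε) := by
  have h1 := (Nat.ceil_lt_add_one (div_nonneg hc.le hε.le)).le
  have h2 := mul_le_mul_of_nonneg_left (le_max_right 1 (1 / ε)) hc.le
  rw [mul_one_div] at h2
  linarith [le_max_left 1 (1 / ε)]

theorem ceil_mul_sq_le {c : ℝ} (hc : 0 < c) {K : ℕ} (hK : 0 < K) :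
    (⌈c * (K : ℝ) ^ 2⌉₊ : ℝ) ≤ (c + 1) * (K : ℝ) ^ 2 := by
  have h1 := (Nat.ceil_lt_add_one (show 0 ≤ c * (K : ℝ) ^ 2 by positivity)).le
  have h2 : (1 : ℝ) ≤ (K : ℝ) ^ 2 := one_le_pow₀ (by exact_mod_cast hK)
  linarith

theorem cast_calls_le {cK cT cS ε : ℝ} (hK0 : 0 < cK) (hT0 : 0 < cT) (hS0 : 0 < cS) (hε : 0 < ε)
    {K T S c M : ℕ} (hK : K = ⌈cK / ε⌉₊) (hT : T = ⌈cT * (K : ℝ) ^ 2⌉₊)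
    (hS : S = ⌈cS * (K : ℝ) ^ 2⌉₊) (hc : c ≤ K * (S * (2 * M) + T * (3 * M + 2))) :
    (c : ℝ) ≤ ((cS + 1) * (2 * M) + (cT + 1) * (3 * M + 2)) * (cK + 1) ^ 3 *
      max 1 (1 / ε ^ 3) := by
  have hKpos : 0 < K := by rw [hK]; exact Nat.ceil_pos.2 (div_pos hK0 hε)
  have h1 : (c : ℝ) ≤ K * (S * (2 * M) + T * (3 * M + 2)) := by exact_mod_cast hc
  have h2 : (K : ℝ) ≤ (cK + 1) * max 1 (1 / ε) := by
    rw [hK]; exact ceil_le_add_one_mul_max hK0 hε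
  have h3 : (T : ℝ) ≤ (cT + 1) * (K : ℝ) ^ 2 := by
    rw [hT]; exact ceil_mul_sq_le hT0 hKpos
  have h4 : (S : ℝ) ≤ (cS + 1) * (K : ℝ) ^ 2 := by
    rw [hS]; exact ceil_mul_sq_le hS0 hKpos
  have h5 : max 1 (1 / ε) ^ 3 = max 1 (1 / ε ^ 3) := by
    rw [← one_div_pow]
    rcases le_total 1 (1 / ε) with h | h
    · rw [max_eq_right h, max_eq_right (one_le_pow₀ h)]
    · rw [max_eq_left h, max_eq_left (pow_le_one₀ (by positivity) h), one_pow]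
  calc (c : ℝ) ≤ K * (S * (2 * M) + T * (3 * M + 2)) := h1
    _ ≤ K * ((cS + 1) * (K : ℝ) ^ 2 * (2 * M) + (cT + 1) * (K : ℝ) ^ 2 * (3 * M + 2)) := by
        gcongr
    _ = ((cS + 1) * (2 * M) + (cT + 1) * (3 * M + 2)) * (K : ℝ) ^ 3 := by ring
    _ ≤ ((cS + 1) * (2 * M) + (cT + 1) * (3 * M + 2)) * ((cK + 1) * max 1 (1 / ε)) ^ 3 := by
        gcongr
    _ = _ := by rw [mul_pow, h5]; ring

theorem exists_pos_forall_le {M : ℕ} (f : Fin M → ℝ) : ∃ c : ℝ, 0 < c ∧ ∀ m, f m ≤ c := by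
  obtain ⟨c, hc⟩ := (Set.finite_range f).bddAbove
  exact ⟨max c 1, by positivity, fun m => (hc ⟨m, rfl⟩).trans (le_max_left _ _)⟩

theorem mainTheorem1 {N M : ℕ} {J : Fin M → ℕ} (P : RobustProblem N M J)
    (hP : P.Standing) (D0 : ℝ) (D B : Fin M → ℝ) (hB : P.BoundedSubdiff D0 D B)
    (α β : ℝ) (hα : 0 < α) (hβ : 0 < β)
    (hαD : α * √(∑ m, D m ^ 2) ≤ 1) (hβD : 2 * β * √(∑ m, D m ^ 2) ≤ 1) :
    ∃ cK cT cS C : ℝ, 0 < cK ∧ 0 < cT ∧ 0 < cS ∧ 0 < C ∧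
      ∀ ε : ℝ, 0 < ε → ∀ K T S : ℕ,
        K = ⌈cK / ε⌉₊ → T = ⌈cT * (K : ℝ) ^ 2⌉₊ → S = ⌈cS * (K : ℝ) ^ 2⌉₊ →
        ∀ find : Vec N → Prog N M J ((m : Fin M) → Vec (J m)),
          (find = findByPick (1 / K) ∨ find = findByAscent S (1 / √S)) →
          ∀ x0 ∈ P.X,
            (proM3 P α β (1 / K) (1 / K) find K T (1 / √T) (1 / √T) x0).Ensures P
              fun x calls =>
                P.IsApproxOptimal ε x ∧ (calls : ℝ) ≤ C * max 1 (1 / ε ^ 3) := by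
  obtain ⟨xs, hxs⟩ := hP.optimum
  obtain ⟨μ, hμ, hμs⟩ := RobustProblem.exists_multipliers hP hB hxs
  obtain ⟨dX, hdX0, hdX⟩ := RobustProblem.exists_diam_bound hP.X_compact
  choose dZ hdZ0 hdZ using fun m => RobustProblem.exists_diam_bound (hP.Z_compact m)
  obtain ⟨A, hA0, hA⟩ := RobustProblem.exists_con_bound hP hB
  obtain ⟨c1, hc1, hbm⟩ := exists_pos_forall_le fun m =>
    RobustProblem.outerBudget α β dX (μ + Pi.single m 1)
  -- `cK` dominates the budgets of all test multipliers, `0` and `μ + Pi.single m 1`.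
  obtain ⟨cK, hcK1, hb0⟩ := exists_ge_ge c1 (RobustProblem.outerBudget α β dX (0 : Fin M → ℝ))
  have hcK0 : 0 < cK := hc1.trans_le hcK1
  -- The multiplier bound does not involve `ε` or `K`, so `a` may be fixed now; `cT = a ^ 2` then
  -- makes `a / √T ≤ 1 / K`. The constant `e` plays this role for `S`.
  obtain ⟨a, ha1, ha⟩ := exists_ge_ge 1
    (RobustProblem.innerConst D0 D B (RobustProblem.multiplierBound α β dX A μ) dX dZ)
  have ha0 : 0 < a := one_pos.trans_le ha1
  obtain ⟨e, he0, he⟩ := exists_pos_forall_le fun m => dZ m ^ 2 / 2 + B m ^ 2 / 2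
  refine ⟨cK, a ^ 2, e ^ 2, ((e ^ 2 + 1) * (2 * M) + (a ^ 2 + 1) * (3 * M + 2)) * (cK + 1) ^ 3,
    hcK0, by positivity, by positivity, by positivity, ?_⟩
  intro ε hε K T S hK hT hS find hfind x0 hx0
  have hKpos : 0 < K := by rw [hK]; exact Nat.ceil_pos.2 (div_pos hcK0 hε)
  have hKr : (0 : ℝ) < K := by exact_mod_cast hKpos
  have hTpos : 0 < T := by rw [hT]; exact Nat.ceil_pos.2 (by positivity)
  have hSpos : 0 < S := by rw [hS]; exact Nat.ceil_pos.2 (by positivity)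
  have hTle : a ^ 2 * (K : ℝ) ^ 2 ≤ T := by rw [hT]; exact Nat.le_ceil _
  have hSle : e ^ 2 * (K : ℝ) ^ 2 ≤ S := by rw [hS]; exact Nat.le_ceil _
  have hKε : cK / K ≤ ε := by
    have h1 : cK / ε ≤ K := by rw [hK]; exact Nat.le_ceil _
    rw [div_le_iff₀ hε] at h1
    rw [div_le_iff₀ hKr]
    linarith
  have hTa := one_div_sqrt_le ha0 le_rfl hKpos hTle
  have hSe := one_div_sqrt_le he0 le_rfl hKpos hSle
  have hfind' : ∀ x ∈ P.X, (find x).Ensures P fun z c =>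
      (∀ m, P.IsApproxMaximiser (1 / K) x m (z m)) ∧ c ≤ S * (2 * M) := by
    intro x hx
    rcases hfind with h | h <;> rw [h]
    · exact (RobustProblem.findByPick_ensures hP hB (one_div_nonneg.2 hKr.le) hx).mono
        fun z c h => ⟨h.1, h.2.le.trans (Nat.zero_le _)⟩
    · exact (RobustProblem.findByAscent_ensures hP hB hdZ hSpos (fun m => le_trans
        (mul_le_mul_of_nonneg_right (he m) (by positivity)) hSe) hx).mono
        fun z c h => ⟨h.1, h.2.le⟩
  have hinner : ∀ (lam : Fin M → ℝ) (x : Vec N), (∀ m, 0 ≤ lam m) →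
      (∀ m, lam m ≤ RobustProblem.multiplierBound α β dX A μ) → x ∈ P.X →
      (innerAlg T α (1 / √T) (1 / √T) lam x).Ensures P fun r c =>
        P.IsStrongApproxSaddle α (1 / K) lam x r.1 r.2 ∧ c ≤ T * (3 * M + 2) :=
    fun lam x hlam hΛ _ => (RobustProblem.innerAlg_ensures hP hB hα hdX hdZ hTpos (le_trans
      (mul_le_mul_of_nonneg_right ha (by positivity)) hTa) hlam hΛ x).mono
      fun r c h => ⟨h.1, h.2.le⟩
  exact (RobustProblem.proM3_ensures hP hB hα hβ hαD hβD hdX hA0 hA hxs hμ hμs hKpos hfind'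
    hinner ((div_le_div_of_nonneg_right hb0 hKr.le).trans hKε)
    (fun m => (div_le_div_of_nonneg_right ((hbm m).trans hcK1) hKr.le).trans hKε) hε.le hx0).mono
    fun x c h => ⟨h.1, cast_calls_le hcK0 (by positivity) (by positivity) hε hK hT hS h.2⟩
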